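/- Let $k,d\ge 0$ be integers, $n=k+d$, let $\Theta$ be an antisymmetric real $n\times n$ matrix, and let $r=(r_1,\dots,r_k,0,\dots,0)\in[0,\infty)^n$ with $r_1,\dots,r_k>0$. For a real antisymmetric $m\times m$ matrix $D$ put $\sigma_D(p,q)=e^{-\pi i\langle p,Dq\rangle}$ for $p,q\in\mathbb N^m$, and let $\mathcal T_r(\mathbb N^m,\sigma_D)$ be the C*-algebra of operators on $\ell^2(\mathbb N^m)$ generated by the isometries $L_p$, $p\in\mathbb N^m$, given by $L_p\delta_q=\sigma_D(p,q)\delta_{p+q}$. Let $\alpha$ be the dynamics on $\mathcal T_r(\mathbb N^n,\sigma_\Theta)$ implemented by the unitaries $\delta_q\mapsto e^{i\langle q,r\rangle t}\delta_q$, so that $\alpha_t(L_p)=e^{i\langle p,r\rangle t}L_p$. A state $\varphi$ is a $\mathrm{KMS}_\beta$ state if $\varphi(AB)=\varphi(B\alpha_{i\beta}(A))$ for every $\alpha$-analytic $A$ and every $B$, and a $\mathrm{KMS}_{0^+}$ state is a weak* limit of $\mathrm{KMS}_\beta$ states as $\beta\to0^+$. Let $\Theta_d$ be the lower right $d\times d$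 corner of $\Theta$. (1) A state $\varphi$ of $\mathcal T_r(\mathbb N^n,\sigma_\Theta)$ is a $\mathrm{KMS}_{0^+}$ state of $(\mathcal T_r(\mathbb N^n,\sigma_\Theta),\alpha)$ if and only if it is a trace and $$\varphi(L_pL_xL_y^*L_q^*)=\delta_{p,q}\,\varphi(L_xL_y^*)\qquad\text{for all } p,q\in\mathbb N^k\times 0_d,\ x,y\in 0_k\times\mathbb N^d.$$ (2) There is a canonical (isometric) $*$-isomorphism of $\mathcal T_r(\mathbb N^d,\sigma_{\Theta_d})$ onto the C*-subalgebra $\mathrm C^*(L_x\mid x\in0_k\times\mathbb N^d)$ of $\mathcal T_r(\mathbb N^n,\sigma_\Theta)$ sending $L_x$ to $L_{(0_k,x)}$ for $x\in\mathbb N^d$. Under this identification, restricting $\varphi$ to $\mathcal T_r(\mathbb N^d,\sigma_{\Theta_d})$ is an affine weak* homeomorphism of the convex set of $\mathrm{KMS}_{0^+}$ states of $(\mathcal T_r(\mathbb N^n,\sigma_\Theta),\alpha)$ onto the convex set of those tracial states $\tau$ of $\mathcal T_r(\mathbb N^d,\sigma_{\Theta_d})$ such that, for all $x,y\in 0_k\times\mathbb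 N^d\cong\mathbb N^d$, $$\tau(L_xL_y^*)=0\quad\text{unless}\quad \langle\Theta(x-y),e_j\rangle\in\mathbb Z\ \text{ for all } 1\le j\le n .$$ -/

import Mathlib

open Filter Topology
open scoped ComplexOrder

noncomputable section

namespace ToeplitzTorus

/-! ### States, traces and equilibrium states of C*-dynamical systems -/

section States

variable {A : Type*} [NormedRing A] [NormedAlgebra ℂ A] [StarRing A]

/-- The state space of a unital C*-algebra `A`: the bounded linear functionals that are positive and
take the value `1` at the unit. The ambient type `WeakDual ℂ A` carries the weak* topology. -/
def states (A : Type*) [NormedRing A] [NormedAlgebra ℂ A] [StarRing A] : Set (WeakDual ℂ A) :=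
  {φ | φ 1 = 1 ∧ ∀ a : A, 0 ≤ φ (star a * a)}

/-- The trace property `φ(ab) = φ(ba)`. -/
def IsTracial (φ : WeakDual ℂ A) : Prop :=
  ∀ a b : A, φ (a * b) = φ (b * a)

/-- `F` is the entire extension of `t ↦ α_t(a)`; the element `a` is analytic for `α` when such an
`F` exists, and then `F z` is the element denoted `α_z(a)`. -/
def IsEntireExtension (α : ℝ → A ≃⋆ₐ[ℂ] A) (a : A) (F : ℂ → A) : Prop :=
  Differentiable ℂ F ∧ ∀ t : ℝ, F (t : ℂ) = α t a

/-- `φ` is a KMS state at inverse temperature `β` for the dynamics `α`: it is a state and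
`φ(ab) = φ(b α_{iβ}(a))` for every `α`-analytic `a` and every `b`. -/
def IsKMS (α : ℝ → A ≃⋆ₐ[ℂ] A) (β : ℝ) (φ : WeakDual ℂ A) : Prop :=
  φ ∈ states A ∧
    ∀ (a : A) (F : ℂ → A), IsEntireExtension α a F →
      ∀ b : A, φ (a * b) = φ (b * F (Complex.I * (β : ℂ)))

/-- `φ` is a `KMS_{0⁺}` state for `α`: it is the weak* limit of a net (here: along a proper filter)
of `KMS_β` states, with the inverse temperatures `β` tending to `0` from the right. -/
def IsKMSZeroPlus (α : ℝ → A ≃⋆ₐ[ℂ] A) (φ : WeakDual ℂ A) : Prop :=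
  ∃ (I : Type) (l : Filter I) (β : I → ℝ) (ψ : I → WeakDual ℂ A),
    l.NeBot ∧ Tendsto β l (𝓝[>] 0) ∧ (∀ i, IsKMS α (β i) (ψ i)) ∧ Tendsto ψ l (𝓝 φ)

/-- The space of `KMS_{0⁺}` states. -/
def kmsZeroPlusStates (α : ℝ → A ≃⋆ₐ[ℂ] A) : Set (WeakDual ℂ A) :=
  {φ | IsKMSZeroPlus α φ}

end States

/-! ### Twisted left regular representations of `ℕ^ι` -/

/-- The Hilbert space `ℓ²(ℕ^ι)`. -/
abbrev Ell2 (ι : Type) : Type := lp (fun _ : ι → ℕ => ℂ) 2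

section Regular

variable {ι : Type}

/-- The canonical orthonormal basis vector `δ_q` of `ℓ²(ℕ^ι)`. -/
def delta (q : ι → ℕ) : Ell2 ι :=
  open scoped Classical in lp.single 2 q (1 : ℂ)

lemma orthonormal_delta : Orthonormal ℂ (delta : (ι → ℕ) → Ell2 ι) := by
  classical
  rw [orthonormal_iff_ite]
  intro p q
  rw [delta, delta, lp.inner_single_left]
  simp [Pi.single_apply]

/-- Given unimodular coefficients `c` and an injection `f` of `ℕ^ι`, the family of the vectors
`c q • δ_{f q}` is orthonormal. -/
lemma orthonormal_smul_delta (c : (ι → ℕ) → Circle) {f : (ι → ℕ) → (ι → ℕ)}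
    (hf : Function.Injective f) :
    Orthonormal ℂ (fun q => (c q : ℂ) • (delta (f q) : Ell2 ι)) := by
  have h := orthonormal_delta.comp f hf
  refine ⟨fun q => ?_, fun p q hpq => ?_⟩
  · rw [norm_smul, Circle.norm_coe, one_mul]
    exact h.1 q
  · have h' := h.2 hpq
    simp only [Function.comp_apply] at h'
    simp only [inner_smul_left, inner_smul_right, h', mul_zero]

/-- The isometry of `ℓ²(ℕ^ι)` with `δ_q ↦ c q • δ_{f q}`, for unimodular `c` and injective `f`. -/
def weightedShift (c : (ι → ℕ) → Circle) (f : (ι → ℕ) → (ι → ℕ))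
    (hf : Function.Injective f) : Ell2 ι →ₗᵢ[ℂ] Ell2 ι :=
  (orthonormal_smul_delta c hf).orthogonalFamily.linearIsometry

lemma weightedShift_delta (c : (ι → ℕ) → Circle) (f : (ι → ℕ) → (ι → ℕ))
    (hf : Function.Injective f) (q : ι → ℕ) :
    weightedShift c f hf (delta q) = (c q : ℂ) • delta (f q) := by
  classical
  have h := (orthonormal_smul_delta c hf).orthogonalFamily.linearIsometry_apply_single
    (i := q) (1 : ℂ)
  rw [weightedShift, delta]
  convert h using 1
  simp

/-- Bounded operators on `ℓ²(ℕ^ι)` are determined by their values on the basis vectors. -/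
lemma ext_delta {S T : Ell2 ι →L[ℂ] Ell2 ι} (h : ∀ q, S (delta q) = T (delta q)) : S = T := by
  classical
  refine ContinuousLinearMap.ext fun x => ?_
  have hx := lp.hasSum_single (p := 2) (by norm_num) x
  have hs : ∀ q, lp.single 2 q (x q) = (x q) • (delta q : Ell2 ι) := by
    intro q
    have : delta q = lp.single (E := fun _ : ι → ℕ => ℂ) 2 q (1 : ℂ) := by
      rw [delta]
    rw [this, ← lp.single_smul]
    simp
  have h1 := hx.mapL S
  have h2 := hx.mapL T
  refine h1.unique ?_
  convert h2 using 2 with q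
  rw [hs, map_smul, map_smul, h]

/-- The operator `L^σ_p` of the left regular `σ`-representation of `ℕ^ι`:
`L^σ_p δ_q = σ(p,q) δ_{p+q}`. -/
def leftRegular (σ : (ι → ℕ) → (ι → ℕ) → Circle) (p : ι → ℕ) : Ell2 ι →L[ℂ] Ell2 ι :=
  (weightedShift (σ p) (p + ·) (add_right_injective p)).toContinuousLinearMap

lemma leftRegular_delta (σ : (ι → ℕ) → (ι → ℕ) → Circle) (p q : ι → ℕ) :
    leftRegular σ p (delta q) = (σ p q : ℂ) • delta (p + q) :=
  weightedShift_delta _ _ (add_right_injective p) q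

/-- The reduced twisted semigroup C*-algebra `T_r(ℕ^ι, σ)`: the C*-algebra of operators on
`ℓ²(ℕ^ι)` generated by the `L^σ_p`, `p ∈ ℕ^ι`. -/
def toeplitz (σ : (ι → ℕ) → (ι → ℕ) → Circle) : StarSubalgebra ℂ (Ell2 ι →L[ℂ] Ell2 ι) :=
  (StarAlgebra.adjoin ℂ (Set.range (leftRegular σ))).topologicalClosure

/-- `L^σ_p` as an element of `T_r(ℕ^ι, σ)`. -/
def gen (σ : (ι → ℕ) → (ι → ℕ) → Circle) (p : ι → ℕ) : toeplitz σ :=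
  ⟨leftRegular σ p, StarSubalgebra.le_topologicalClosure _
    (StarAlgebra.subset_adjoin ℂ _ (Set.mem_range_self p))⟩

/-! ### The dynamics -/

variable [Fintype ι]

/-- The phase `e^{i⟨q,r⟩t}`. -/
def phase (r : ι → ℝ) (t : ℝ) (q : ι → ℕ) : Circle :=
  Circle.exp ((∑ j, (q j : ℝ) * r j) * t)

lemma phase_neg (r : ι → ℝ) (t : ℝ) (q : ι → ℕ) : phase r (-t) q * phase r t q = 1 := by
  rw [phase, phase, ← Circle.exp_add]
  simp

lemma phase_add (r : ι → ℝ) (t : ℝ) (p q : ι → ℕ) :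
    phase r t (p + q) = phase r t p * phase r t q := by
  rw [phase, phase, phase, ← Circle.exp_add, ← add_mul, ← Finset.sum_add_distrib]
  simp [add_mul]

/-- The diagonal operator `u^r_t δ_q = e^{i⟨q,r⟩t} δ_q`. -/
def diagOp (r : ι → ℝ) (t : ℝ) : Ell2 ι →L[ℂ] Ell2 ι :=
  (weightedShift (phase r t) id Function.injective_id).toContinuousLinearMap

lemma diagOp_delta (r : ι → ℝ) (t : ℝ) (q : ι → ℕ) :
    diagOp r t (delta q) = (phase r t q : ℂ) • delta q :=
  weightedShift_delta _ _ Function.injective_id q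

lemma star_diagOp_mul (r : ι → ℝ) (t : ℝ) : star (diagOp r t) * diagOp r t = 1 := by
  rw [ContinuousLinearMap.star_eq_adjoint]
  exact (ContinuousLinearMap.norm_map_iff_adjoint_comp_self _).1
    (fun x => (weightedShift (phase r t) id Function.injective_id).norm_map x)

lemma diagOp_mul_neg (r : ι → ℝ) (t : ℝ) : diagOp r t * diagOp r (-t) = 1 := by
  refine ext_delta fun q => ?_
  have h : ((phase r (-t) q : Circle) : ℂ) * (phase r t q : ℂ) = 1 := by
    rw [← Circle.coe_mul, phase_neg, Circle.coe_one]
  rw [mul_apply_eq_comp, diagOp_delta, map_smul, diagOp_delta, smul_smul, h, one_smul]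
  rfl

lemma star_diagOp (r : ι → ℝ) (t : ℝ) : star (diagOp r t) = diagOp r (-t) :=
  left_inv_eq_right_inv (star_diagOp_mul r t) (diagOp_mul_neg r t)

/-- The unitary `u^r_t`. -/
def diagUnitary (r : ι → ℝ) (t : ℝ) : unitary (Ell2 ι →L[ℂ] Ell2 ι) :=
  ⟨diagOp r t, Unitary.mem_iff.2 ⟨star_diagOp_mul r t, by rw [star_diagOp, diagOp_mul_neg]⟩⟩

/-- Conjugation by the unitary `u^r_t` on all bounded operators. -/
def conj (r : ι → ℝ) (t : ℝ) : (Ell2 ι →L[ℂ] Ell2 ι) ≃⋆ₐ[ℂ] (Ell2 ι →L[ℂ] Ell2 ι) :=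
  Unitary.conjStarAlgAut ℂ _ (diagUnitary r t)

lemma conj_apply (r : ι → ℝ) (t : ℝ) (T : Ell2 ι →L[ℂ] Ell2 ι) :
    conj r t T = diagOp r t * T * star (diagOp r t) := rfl

lemma conj_leftRegular (r : ι → ℝ) (t : ℝ) (σ : (ι → ℕ) → (ι → ℕ) → Circle) (p : ι → ℕ) :
    conj r t (leftRegular σ p) = (phase r t p : ℂ) • leftRegular σ p := by
  rw [conj_apply, star_diagOp]
  refine ext_delta fun q => ?_
  have h : ((phase r (-t) q : Circle) : ℂ) * (phase r t q : ℂ) = 1 := by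
    rw [← Circle.coe_mul, phase_neg, Circle.coe_one]
  simp only [mul_apply_eq_comp, smul_apply, diagOp_delta,
    leftRegular_delta, map_smul, smul_smul, phase_add, Circle.coe_mul]
  congr 1
  linear_combination ((σ p q : ℂ) * (phase r t p : ℂ)) * h

lemma conj_mem (r : ι → ℝ) (t : ℝ) (σ : (ι → ℕ) → (ι → ℕ) → Circle)
    {T : Ell2 ι →L[ℂ] Ell2 ι} (hT : T ∈ toeplitz σ) : conj r t T ∈ toeplitz σ := by
  have hc : Continuous (conj r t : (Ell2 ι →L[ℂ] Ell2 ι) → _) := by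
    have : (conj r t : (Ell2 ι →L[ℂ] Ell2 ι) → _)
        = fun T => diagOp r t * T * star (diagOp r t) := funext fun T => conj_apply r t T
    rw [this]
    fun_prop
  have hcl : IsClosed ((toeplitz σ).comap (conj r t).toStarAlgHom :
      Set (Ell2 ι →L[ℂ] Ell2 ι)) :=
    (StarSubalgebra.isClosed_topologicalClosure _).preimage hc
  have hle : toeplitz σ ≤ (toeplitz σ).comap (conj r t).toStarAlgHom := by
    refine StarSubalgebra.topologicalClosure_minimal (StarAlgebra.adjoin_le ?_) hcl
    rintro _ ⟨p, rfl⟩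
    change conj r t (leftRegular σ p) ∈ toeplitz σ
    rw [conj_leftRegular]
    exact (toeplitz σ).smul_mem (gen σ p).2 _
  exact hle hT

lemma conj_neg_conj (r : ι → ℝ) (t : ℝ) (T : Ell2 ι →L[ℂ] Ell2 ι) :
    conj r (-t) (conj r t T) = T := by
  have h1 := diagOp_mul_neg r (-t)
  rw [neg_neg] at h1
  rw [conj_apply, conj_apply, star_diagOp, star_diagOp, neg_neg]
  calc diagOp r (-t) * (diagOp r t * T * diagOp r (-t)) * diagOp r t
      = (diagOp r (-t) * diagOp r t) * T * (diagOp r (-t) * diagOp r t) := by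
        simp only [mul_assoc]
    _ = T := by rw [h1, one_mul, mul_one]

/-- The dynamics `α^r_t(X) = u^r_t X (u^r_t)^*` on `T_r(ℕ^ι, σ)`. -/
def dynamics (σ : (ι → ℕ) → (ι → ℕ) → Circle) (r : ι → ℝ) (t : ℝ) :
    toeplitz σ ≃⋆ₐ[ℂ] toeplitz σ where
  toFun X := ⟨conj r t X, conj_mem r t σ X.2⟩
  invFun X := ⟨conj r (-t) X, conj_mem r (-t) σ X.2⟩
  left_inv X := Subtype.ext (conj_neg_conj r t X)
  right_inv X := Subtype.ext (by simpa using conj_neg_conj r (-t) (X : Ell2 ι →L[ℂ] Ell2 ι))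
  map_mul' X Y := Subtype.ext (map_mul (conj r t) _ _)
  map_add' X Y := Subtype.ext (map_add (conj r t) _ _)
  map_star' X := Subtype.ext (map_star (conj r t) _)
  map_smul' c X := Subtype.ext (map_smul (conj r t) c _)

/-- On generators the dynamics is `α^r_t(L_p) = e^{i⟨p,r⟩t} L_p`. -/
lemma dynamics_gen (σ : (ι → ℕ) → (ι → ℕ) → Circle) (r : ι → ℝ) (t : ℝ) (p : ι → ℕ) :
    dynamics σ r t (gen σ p) = (phase r t p : ℂ) • gen σ p :=
  Subtype.ext (conj_leftRegular r t σ p)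

/-! ### The cocycle of an antisymmetric matrix -/

/-- `σ_Θ(p,q) = e^{-πi⟨p,Θq⟩}`. -/
def cocycle (Θ : Matrix ι ι ℝ) (p q : ι → ℕ) : Circle :=
  Circle.exp (-Real.pi * ((fun j => (p j : ℝ)) ⬝ᵥ Θ.mulVec (fun j => (q j : ℝ))))

end Regular

/-! ### The two blocks of coordinates -/

section Blocks

variable {k d : ℕ}

/-- The inclusion `ℕ^k ≅ ℕ^k × 0_d ⊆ ℕ^{k+d}`. -/
def inl (p : Fin k → ℕ) : Fin (k + d) → ℕ := Fin.append p 0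

/-- The inclusion `ℕ^d ≅ 0_k × ℕ^d ⊆ ℕ^{k+d}`. -/
def inr (x : Fin d → ℕ) : Fin (k + d) → ℕ := Fin.append 0 x

/-- The lower right `d × d` corner `Θ_d` of `Θ`. -/
def corner (Θ : Matrix (Fin (k + d)) (Fin (k + d)) ℝ) : Matrix (Fin d) (Fin d) ℝ :=
  Θ.submatrix (Fin.natAdd k) (Fin.natAdd k)

/-- The C*-subalgebra `C*(L_x : x ∈ 0_k × ℕ^d)` of `T_r(ℕ^{k+d}, σ_Θ)`. -/
def fixedBlock (Θ : Matrix (Fin (k + d)) (Fin (k + d)) ℝ) :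
    StarSubalgebra ℂ (toeplitz (cocycle Θ)) :=
  (StarAlgebra.adjoin ℂ
    (Set.range fun x : Fin d → ℕ => gen (cocycle Θ) (inr x))).topologicalClosure

/-- `L_x` as an element of `C*(L_x : x ∈ 0_k × ℕ^d)`. -/
def fixedGen (Θ : Matrix (Fin (k + d)) (Fin (k + d)) ℝ) (x : Fin d → ℕ) : fixedBlock Θ :=
  ⟨gen (cocycle Θ) (inr x), StarSubalgebra.le_topologicalClosure _
    (StarAlgebra.subset_adjoin ℂ _ (Set.mem_range_self x))⟩

/-- `⟨Θ(x - y), e_j⟩ ∈ ℤ` for all `1 ≤ j ≤ k + d`, where `x, y ∈ 0_k × ℕ^d`. -/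
def IsIntegralDiff (Θ : Matrix (Fin (k + d)) (Fin (k + d)) ℝ) (x y : Fin d → ℕ) : Prop :=
  ∀ j : Fin (k + d), ∃ m : ℤ,
    Θ.mulVec (fun i => (inr (k := k) x i : ℝ) - (inr (k := k) y i : ℝ)) j = (m : ℝ)

/-- The tracial states `τ` of `T_r(ℕ^d, σ_{Θ_d})` such that, for all `x, y`,
`τ(L_x L_y^*) = 0` unless `⟨Θ(x - y), e_j⟩ ∈ ℤ` for all `j`. -/
def plusTraces (Θ : Matrix (Fin (k + d)) (Fin (k + d)) ℝ) :
    Set (WeakDual ℂ (toeplitz (cocycle (corner Θ)))) :=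
  {τ | τ ∈ states (toeplitz (cocycle (corner Θ))) ∧ IsTracial τ ∧
    ∀ x y : Fin d → ℕ, ¬ IsIntegralDiff Θ x y →
      τ (gen (cocycle (corner Θ)) x * star (gen (cocycle (corner Θ)) y)) = 0}

end Blocks

end ToeplitzTorus

end

open ToeplitzTorus

noncomputable section

set_option linter.unusedSectionVars false

/-! Forward direction. In a KMS_β state, carrying an eigenvector of frequency l around costs a
factor e^{-βl} (`IsKMS.apply_eigen_mul`). For β > 0, write X = L_x L_y^* and move L_p in φ(L_p X
L_q^*) to the right end. If p = q it meets L_p^* and the value is e^{-β⟨p,r⟩} φ(X). If p ≠ q, the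
common part p ⊓ q cancels and leaves disjoint exponents, not both zero. These commute with
everything in sight up to phases, so the value v satisfies |v| = e|v| with e < 1 and vanishes
(`IsKMS.apply_blockProd`). As β → 0⁺ all factors tend to 1: the limit has the product formula, and
it is a trace because eigenvectors generate. As the products L_p L_x L_y^* L_q^* have dense span,
such a limit is determined by its values on the second block (`eq_of_restrict_eq`).

Restrictions. A tracial state treats every isometry as a unitary, and conjugation by L_s multiplies
L_x L_y^* by a phase which is 1 for all s exactly when Θ(x-y) is integral. So every trace restricts
into `plusTraces` (`restrict_mem_plusTraces`).

Converse. Let E be the compression to ℓ²(ℕ^d). On C*(L_x) it is multiplicative, since the projection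
onto ℓ²(ℕ^d) commutes with that algebra, and injective, since right translations by ℕ^k do too. Its
inverse there is the canonical isomorphism. For τ in `plusTraces`, the normalised sum over s in ℕ^k
of e^{-β⟨s,r⟩} τ(E(L_s^* a L_s)) is a KMS_β state extending τ (`exists_isKMS`): the shift s ↦ p + s
gives the KMS relation for L_p, and the integrality condition keeps the restriction equal to τ.
Compactness of the state space yields a limit as β → 0⁺ that still extends τ. This is surjectivity
of restriction; with uniqueness it also shows that any trace with the product formula is a KMS_{0⁺}
state. Finally, a continuous bijection from a compact space to a Hausdorff space is a homeomorphism.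
-/

namespace ToeplitzTorus

/-! ### Dense spans in algebras with a *-generating set -/

section Dense

variable {A : Type*} [NormedRing A] [NormedAlgebra ℂ A] [StarRing A] [StarModule ℂ A]

/-- A subspace containing `1` and stable under left multiplication by the elements of a
`*`-generating set and by their adjoints is dense. -/
lemma dense_of_mul_mem {G : Set A} (hG : Dense (StarAlgebra.adjoin ℂ G : Set A))
    (V : Submodule ℂ A) (h1 : (1 : A) ∈ V) (hmul : ∀ g ∈ G, ∀ a ∈ V, g * a ∈ V)
    (hstar : ∀ g ∈ G, ∀ a ∈ V, star g * a ∈ V) : Dense (V : Set A) := by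
  refine hG.mono fun a ha => ?_
  have h : a ∈ Subalgebra.toSubmodule (Algebra.adjoin ℂ (G ∪ star G)) := by
    rw [← StarAlgebra.adjoin_toSubalgebra]
    exact ha
  rw [Algebra.adjoin_eq_span] at h
  refine (Submodule.span_le.2 ?_) h
  intro m hm
  induction hm using Submonoid.closure_induction_left with
  | one => exact h1
  | mul_left x hx y hy ih =>
    rcases hx with hx | hx
    · exact hmul x hx y ih
    · have := hstar (star x) hx y ih
      rwa [star_star] at this

/-- Converts a closure taken in `B` into density inside the subtype `S`: the inclusion carries the
algebra generated by `g` onto the one generated by `f`. -/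
lemma dense_adjoin_preimage {B : Type*} [NormedRing B] [NormedAlgebra ℂ B] [StarRing B]
    [StarModule ℂ B] [ContinuousStar B] {ι : Type*} (f : ι → B) (S : StarSubalgebra ℂ B)
    (hS : S = (StarAlgebra.adjoin ℂ (Set.range f)).topologicalClosure)
    (g : ι → S) (hg : ∀ i, (g i : B) = f i) :
    Dense (StarAlgebra.adjoin ℂ (Set.range g) : Set S) := by
  rw [Subtype.dense_iff]
  have h : (Subtype.val '' (StarAlgebra.adjoin ℂ (Set.range g) : Set S) : Set B)
      = StarAlgebra.adjoin ℂ (Set.range f) := by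
    have h2 := StarAlgHom.map_adjoin S.subtype (Set.range g)
    have h3 : (S.subtype '' Set.range g) = Set.range f := by
      rw [← Set.range_comp]
      congr 1
      funext i
      exact hg i
    rw [h3] at h2
    rw [← h2]
    rfl
  intro x hx
  have hx' : x ∈ closure (StarAlgebra.adjoin ℂ (Set.range f) : Set B) := by
    have hx2 : x ∈ S := hx
    rw [hS] at hx2
    exact hx2
  rw [← h] at hx'
  exact hx'

lemma dense_span_of_mul_mem_span {G : Set A} (hG : Dense (StarAlgebra.adjoin ℂ G : Set A))
    {M : Set A} (h1 : (1 : A) ∈ Submodule.span ℂ M)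
    (hmul : ∀ g ∈ G, ∀ x ∈ M, g * x ∈ Submodule.span ℂ M)
    (hstar : ∀ g ∈ G, ∀ x ∈ M, star g * x ∈ Submodule.span ℂ M) :
    Dense (Submodule.span ℂ M : Set A) := by
  have key : ∀ g : A, (∀ x ∈ M, g * x ∈ Submodule.span ℂ M) →
      ∀ x ∈ Submodule.span ℂ M, g * x ∈ Submodule.span ℂ M := by
    intro g hg x hx
    induction hx using Submodule.span_induction with
    | mem x hx => exact hg x hx
    | zero => simp
    | add x y _ _ hx hy => rw [mul_add]; exact add_mem hx hy
    | smul c x _ hx => rw [mul_smul_comm]; exact Submodule.smul_mem _ _ hx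
  exact dense_of_mul_mem hG _ h1 (fun g hg => key g (hmul g hg)) fun g hg => key _ (hstar g hg)

lemma dense_span_of_mul_mem {G : Set A} (hG : Dense (StarAlgebra.adjoin ℂ G : Set A))
    {M : Set A} (h1 : (1 : A) ∈ M) (hGM : G ⊆ M) (hmul : ∀ x ∈ M, ∀ y ∈ M, x * y ∈ M)
    (hstar : ∀ x ∈ M, star x ∈ M) : Dense (Submodule.span ℂ M : Set A) :=
  dense_span_of_mul_mem_span hG (Submodule.subset_span h1)
    (fun g hg x hx => Submodule.subset_span (hmul g (hGM hg) x hx))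
    fun g hg x hx => Submodule.subset_span (hmul _ (hstar g (hGM hg)) x hx)

/-- Normal ordering: multiplying L_p L_q^* on the left by a generator or its adjoint gives a
multiple of another such product, so their span is stable. -/
lemma dense_span_range_mul_star {ι : Type*} {L : (ι → ℕ) → A}
    (hG : Dense (StarAlgebra.adjoin ℂ (Set.range L) : Set A)) (h0 : L 0 = 1)
    (hm : ∀ p q, ∃ c : ℂ, L p * L q = c • L (p + q))
    (hs : ∀ s p, ∃ (c : ℂ) (p' s' : ι → ℕ), star (L s) * L p = c • (L p' * star (L s'))) :
    Dense (Submodule.span ℂ (Set.range fun pq : (ι → ℕ) × (ι → ℕ) => L pq.1 * star (L pq.2)) :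
      Set A) := by
  set S := Set.range fun pq : (ι → ℕ) × (ι → ℕ) => L pq.1 * star (L pq.2) with hS
  have hmem : ∀ (c : ℂ) (p q : ι → ℕ), c • (L p * star (L q)) ∈ Submodule.span ℂ S :=
    fun c p q => Submodule.smul_mem _ c (Submodule.subset_span ⟨(p, q), rfl⟩)
  refine dense_span_of_mul_mem_span hG ?_ ?_ ?_
  · have h := hmem 1 0 0
    rwa [h0, star_one, mul_one, one_smul] at h
  · rintro _ ⟨s, rfl⟩ _ ⟨⟨p, q⟩, rfl⟩
    obtain ⟨c, hc⟩ := hm s p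
    rw [← mul_assoc, hc, smul_mul_assoc]
    exact hmem _ _ _
  · rintro _ ⟨s, rfl⟩ _ ⟨⟨p, q⟩, rfl⟩
    obtain ⟨c, p', s', hc⟩ := hs s p
    obtain ⟨c2, hc2⟩ := hm q s'
    rw [← mul_assoc, hc, smul_mul_assoc, mul_assoc, ← star_mul, hc2, star_smul, mul_smul_comm,
      smul_smul]
    exact hmem _ _ _

end Dense

/-! ### States: Cauchy–Schwarz, contractivity, weak* compactness -/

section States

variable {A : Type*} [NormedRing A] [NormedAlgebra ℂ A] [StarRing A] {φ : WeakDual ℂ A}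

lemma isClosed_states : IsClosed (states A) := by
  have h : states A = {φ : WeakDual ℂ A | φ 1 = 1} ∩
      ⋂ a : A, {φ : WeakDual ℂ A | 0 ≤ φ (star a * a)} := by
    ext φ
    simp [states]
  rw [h]
  refine (isClosed_eq (WeakDual.eval_continuous _) continuous_const).inter
    (isClosed_iInter fun a => ?_)
  exact isClosed_le continuous_const (WeakDual.eval_continuous _)

lemma isClosed_tracial : IsClosed {φ : WeakDual ℂ A | IsTracial φ} := by
  have h : {φ : WeakDual ℂ A | IsTracial φ} =
      ⋂ a : A, ⋂ b : A, {φ : WeakDual ℂ A | φ (a * b) = φ (b * a)} := by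
    ext φ
    simp [IsTracial]
  rw [h]
  exact isClosed_iInter fun a => isClosed_iInter fun b =>
    isClosed_eq (WeakDual.eval_continuous _) (WeakDual.eval_continuous _)

lemma convex_states : Convex ℝ (states A) := by
  intro φ hφ ψ hψ s t hs ht hst
  have hev : ∀ a, (s • φ + t • ψ) a = (s : ℂ) * φ a + (t : ℂ) * ψ a := fun a => by
    change s • φ a + t • ψ a = _
    simp
  refine ⟨?_, fun a => ?_⟩
  · rw [hev, hφ.1, hψ.1, mul_one, mul_one]
    exact_mod_cast hst
  · rw [hev]
    exact add_nonneg (mul_nonneg (by exact_mod_cast hs) (hφ.2 a))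
      (mul_nonneg (by exact_mod_cast ht) (hψ.2 a))

variable [StarModule ℂ A]

/-- Positivity at 1 + a and 1 + ia forces φ(a) + φ(a^*) and i(φ(a) - φ(a^*)) to be real. -/
lemma states_map_star (hφ : φ ∈ states A) (a : A) : φ (star a) = star (φ a) := by
  have h0 := (Complex.le_def.1 (hφ.2 a)).2
  have h1 := (Complex.le_def.1 (hφ.2 (1 + a))).2
  have h2 := (Complex.le_def.1 (hφ.2 (1 + Complex.I • a))).2
  simp only [star_add, star_one, star_smul, add_mul, mul_add, one_mul, mul_one, map_add, hφ.1,
    smul_mul_assoc, mul_smul_comm, map_smul, smul_eq_mul, RCLike.star_def, Complex.conj_I] at h1 h2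
  simp at h0 h1 h2
  apply Complex.ext <;> simp <;> linarith

/-- The Cauchy–Schwarz inequality for states. -/
lemma states_cauchy_schwarz (hφ : φ ∈ states A) (a b : A) :
    ‖φ (star a * b)‖ ^ 2 ≤ (φ (star a * a)).re * (φ (star b * b)).re := by
  set z := φ (star a * b) with hz
  have hz' : φ (star b * a) = star z := by
    rw [hz, ← states_map_star hφ, star_mul, star_star]
  -- Positivity at a - t z̄ b, where the factor z̄ makes the cross terms real. The discriminant of
  -- this quadratic in t is the inequality multiplied by |z|², so z = 0 is treated apart.
  have key : ∀ t : ℝ, 0 ≤ (‖z‖ ^ 2 * (φ (star b * b)).re) * (t * t)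
      + (-2 * ‖z‖ ^ 2) * t + (φ (star a * a)).re := by
    intro t
    have h := (Complex.le_def.1 (hφ.2 (a + (-(t : ℂ) * star z) • b))).1
    have hb := (Complex.le_def.1 (hφ.2 b)).2
    have hn : ‖z‖ ^ 2 = z.re * z.re + z.im * z.im := by
      rw [← Complex.normSq_eq_norm_sq, Complex.normSq_apply]
    simp only [star_add, star_smul, add_mul, mul_add, map_add, smul_mul_assoc, mul_smul_comm,
      map_smul, smul_eq_mul, hz', ← hz] at h
    simp at h hb
    rw [← hb] at h
    rw [hn]
    nlinarith [h]
  have hd := discrim_le_zero key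
  rw [discrim] at hd
  have ha : 0 ≤ (φ (star a * a)).re := (Complex.le_def.1 (hφ.2 a)).1
  have hb : 0 ≤ (φ (star b * b)).re := (Complex.le_def.1 (hφ.2 b)).1
  rcases (norm_nonneg z).eq_or_lt with h0 | h0
  · rw [← h0]
    nlinarith [mul_nonneg ha hb]
  · have h2 : 0 < ‖z‖ ^ 2 := by positivity
    refine le_of_mul_le_mul_left ?_ h2
    nlinarith

lemma states_norm_sq_le (hφ : φ ∈ states A) (a : A) :
    ‖φ a‖ ^ 2 ≤ (φ (star a * a)).re := by
  have h := states_cauchy_schwarz hφ 1 a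
  simpa [hφ.1] using h

/-- States are contractive. -/
lemma states_norm_le [CStarRing A] (hφ : φ ∈ states A) (a : A) : ‖φ a‖ ≤ ‖a‖ := by
  set h := star a * a with hh
  have hsa : star h = h := by rw [hh, star_mul, star_star]
  -- Iterating Cauchy–Schwarz against 1 gives φ(h)^(2^n) ≤ φ(h^(2^n)) ≤ ‖φ‖ ‖h‖^(2^n). For large n
  -- this excludes φ(h) > ‖h‖, whatever the finite norm of φ.
  have hpow : ∀ n : ℕ, (φ h).re ^ (2 ^ n) ≤ (φ (h ^ (2 ^ n))).re := by
    intro n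
    induction n with
    | zero => simp
    | succ n ih =>
      have h0 : 0 ≤ (φ h).re := (Complex.le_def.1 (hφ.2 a)).1
      have h1 := states_norm_sq_le hφ (h ^ 2 ^ n)
      rw [star_pow, hsa, ← pow_add, ← two_mul, ← pow_succ'] at h1
      refine le_trans ?_ h1
      rw [pow_succ, pow_mul]
      have h2 : (φ h).re ^ 2 ^ n ≤ ‖φ (h ^ 2 ^ n)‖ := ih.trans (Complex.re_le_norm _)
      gcongr
  have hle : (φ h).re ≤ ‖h‖ := by
    by_contra! hlt
    have hpos : 0 < ‖h‖ := by
      rcases (norm_nonneg h).eq_or_lt with h0 | h0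
      · rw [norm_eq_zero.1 h0.symm] at hlt
        simp at hlt
      · exact h0
    have hr : 1 < (φ h).re / ‖h‖ := (one_lt_div hpos).2 hlt
    obtain ⟨n, hn⟩ := pow_unbounded_of_one_lt ‖WeakDual.toStrongDual φ‖ hr
    have h2 : ((φ h).re / ‖h‖) ^ n ≤ ((φ h).re / ‖h‖) ^ (2 ^ n) :=
      pow_le_pow_right₀ hr.le Nat.lt_two_pow_self.le
    have h3 : (φ h).re ^ (2 ^ n) ≤ ‖WeakDual.toStrongDual φ‖ * ‖h‖ ^ (2 ^ n) := by
      refine (hpow n).trans ((Complex.re_le_norm _).trans ?_)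
      refine ((WeakDual.toStrongDual φ).le_opNorm _).trans ?_
      gcongr
      exact norm_pow_le' _ (by positivity)
    rw [div_pow, div_pow] at h2
    have h4 := (div_le_iff₀ (pow_pos hpos (2 ^ n))).2 h3
    rw [div_pow] at hn
    linarith
  have h5 := (states_norm_sq_le hφ a).trans hle
  rw [hh, CStarRing.norm_star_mul_self] at h5
  nlinarith [norm_nonneg a, norm_nonneg (φ a)]

/-- Banach–Alaoglu, since states lie in the dual unit ball. -/
lemma isCompact_of_isClosed_subset_states [CStarRing A] {S : Set (WeakDual ℂ A)}
    (hS : IsClosed S) (hs : S ⊆ states A) : IsCompact S := by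
  refine (WeakDual.isCompact_closedBall (𝕜 := ℂ) (E := A) 0 1).of_isClosed_subset hS ?_
  intro φ hφ
  rw [Set.mem_preimage, mem_closedBall_zero_iff]
  refine ContinuousLinearMap.opNorm_le_bound _ zero_le_one fun a => ?_
  rw [one_mul]
  exact states_norm_le (hs hφ) a

/-- For a tracial state every isometry is unitary up to null elements. -/
lemma tracial_mul_isometry (hφ : φ ∈ states A) (ht : IsTracial φ) {L : A}
    (hL : star L * L = 1) (a : A) : φ (a * (L * star L)) = φ a := by
  set P := 1 - L * star L with hP
  have hPP : star P * P = P := by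
    have h : L * star L * (L * star L) = L * star L := by
      rw [mul_assoc, ← mul_assoc (star L), hL, one_mul]
    simp only [hP, star_sub, star_one, star_mul, star_star, sub_mul, mul_sub, one_mul, mul_one, h]
    abel
  have h0 : φ P = 0 := by
    rw [hP, map_sub, ht L (star L), hL, sub_self]
  -- P is a projection with φ(P) = φ(1) - φ(L^* L) = 0, so Cauchy–Schwarz kills φ(aP) for every a.
  have h1 := states_cauchy_schwarz hφ (star a) P
  rw [hPP, h0, star_star, Complex.zero_re, mul_zero] at h1
  have h2 : φ (a * P) = 0 := by
    rw [← norm_eq_zero]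
    nlinarith [norm_nonneg (φ (a * P))]
  rw [hP, mul_sub, mul_one, map_sub, sub_eq_zero] at h2
  exact h2.symm

end States

/-! ### KMS states and eigenvectors of the dynamics -/

section KMS

variable {A : Type*} [NormedRing A] [NormedAlgebra ℂ A] [StarRing A] {φ : WeakDual ℂ A}
  {α : ℝ → A ≃⋆ₐ[ℂ] A} {β : ℝ}

/-- `a` is an eigenvector of the dynamics with frequency `l`. -/
def IsEigen (α : ℝ → A ≃⋆ₐ[ℂ] A) (l : ℝ) (a : A) : Prop :=
  ∀ t : ℝ, α t a = Complex.exp (Complex.I * t * l) • a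

lemma IsEigen.one : IsEigen α 0 1 := fun t => by simp

lemma IsEigen.mul {l m : ℝ} {a b : A} (ha : IsEigen α l a) (hb : IsEigen α m b) :
    IsEigen α (l + m) (a * b) := fun t => by
  rw [map_mul, ha t, hb t, smul_mul_smul_comm, ← Complex.exp_add]
  congr 2
  push_cast
  ring

lemma IsEigen.star [StarModule ℂ A] {l : ℝ} {a : A} (ha : IsEigen α l a) :
    IsEigen α (-l) (star a) := fun t => by
  rw [map_star, ha t, star_smul, RCLike.star_def, ← Complex.exp_conj]
  congr 2
  simp

/-- The entire extension of an eigenvector is z ↦ e^{izl} a, whose value at z = iβ carries the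
factor e^{-βl}. -/
lemma IsKMS.apply_eigen_mul (h : IsKMS α β φ) {l : ℝ} {a : A} (ha : IsEigen α l a) (b : A) :
    φ (a * b) = Complex.exp (-(β * l : ℝ)) * φ (b * a) := by
  have hF : IsEntireExtension α a fun z => Complex.exp (Complex.I * z * l) • a := by
    refine ⟨?_, fun t => (ha t).symm⟩
    fun_prop
  rw [h.2 a _ hF b, mul_smul_comm, map_smul, smul_eq_mul]
  congr 2
  push_cast
  linear_combination (β * l : ℂ) * Complex.I_mul_I

/-- Identity theorem: the real points accumulate at 0. -/
lemma eq_of_eq_on_real {f g : ℂ → ℂ} (hf : Differentiable ℂ f) (hg : Differentiable ℂ g)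
    (h : ∀ t : ℝ, f t = g t) : f = g := by
  refine AnalyticOnNhd.eq_of_frequently_eq (z₀ := 0)
    (hf.differentiableOn.analyticOnNhd isOpen_univ)
    (hg.differentiableOn.analyticOnNhd isOpen_univ) ?_
  have ht : Tendsto (fun t : ℝ => (t : ℂ)) (𝓝[≠] 0) (𝓝[≠] 0) := by
    refine tendsto_nhdsWithin_iff.2 ⟨?_, ?_⟩
    · exact (Complex.continuous_ofReal.tendsto' 0 0 Complex.ofReal_zero).mono_left
        nhdsWithin_le_nhds
    · filter_upwards [self_mem_nhdsWithin] with t ht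
      simpa using ht
  exact ht.frequently (Eventually.of_forall h).frequently

variable [StarModule ℂ A]

/-- The KMS condition may be checked on a `*`-generating set of eigenvectors. -/
lemma isKMS_of_eigen {G : Set A} (hG : Dense (StarAlgebra.adjoin ℂ G : Set A))
    (hφ : φ ∈ states A) (hinv : ∀ t a, φ (α t a) = φ a)
    (h : ∀ b ∈ G, ∃ l : ℝ, IsEigen α l b ∧
      ∀ a, φ (a * b) = Complex.exp (β * l : ℝ) * φ (b * a)) : IsKMS α β φ := by
  refine ⟨hφ, fun a F hF => ?_⟩
  -- The eigenvector is placed on the right, so that the analytic element a stays fixed. This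
  -- relation is stable under products and adjoints, hence spreads from `G` to a set with dense
  -- span.
  set M : Set A := {b | ∃ l : ℝ, IsEigen α l b ∧
      ∀ a, φ (a * b) = Complex.exp (β * l : ℝ) * φ (b * a)} with hM
  have hM1 : (1 : A) ∈ M := ⟨0, IsEigen.one, fun a => by simp⟩
  have hMmul : ∀ x ∈ M, ∀ y ∈ M, x * y ∈ M := by
    rintro x ⟨l, hl, hx⟩ y ⟨m, hm, hy⟩
    refine ⟨l + m, hl.mul hm, fun a => ?_⟩
    rw [← mul_assoc, hy, ← mul_assoc, hx, ← mul_assoc, ← mul_assoc, ← Complex.exp_add]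
    congr 2
    push_cast
    ring
  have hMstar : ∀ x ∈ M, star x ∈ M := by
    rintro x ⟨l, hl, hx⟩
    refine ⟨-l, hl.star, fun a => ?_⟩
    have h1 := congrArg star (hx (star a))
    rw [star_mul', ← states_map_star hφ, ← states_map_star hφ, star_mul, star_mul, star_star,
      RCLike.star_def, ← Complex.exp_conj, Complex.conj_ofReal] at h1
    rw [h1, ← mul_assoc, ← Complex.exp_add]
    simp
  have hVd := dense_span_of_mul_mem hG hM1 h hMmul hMstar
  -- By invariance z ↦ e^{izl} φ(b F(z)) is constant on ℝ, hence on ℂ; its value at iβ is the KMS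
  -- relation.
  have hMeq : ∀ b ∈ M, φ (a * b) = φ (b * F (Complex.I * β)) := by
    rintro b ⟨l, hl, hb⟩
    have hdiff : Differentiable ℂ fun z => φ (b * F z) :=
      (WeakDual.toStrongDual φ).differentiable.comp (hF.1.const_mul b)
    have heq : (fun z : ℂ => Complex.exp (Complex.I * z * l) * φ (b * F z))
        = fun _ => φ (b * a) := by
      refine eq_of_eq_on_real (Differentiable.mul (by fun_prop) hdiff) (by fun_prop) fun t => ?_
      rw [hF.2 t, ← hinv t (b * a), map_mul (α t), hl t, smul_mul_assoc, map_smul, smul_eq_mul]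
    have h1 := congrFun heq (Complex.I * β)
    rw [hb a, ← h1, ← mul_assoc, ← Complex.exp_add]
    have : ((β * l : ℝ) : ℂ) + Complex.I * (Complex.I * β) * l = 0 := by
      push_cast
      linear_combination (β * l : ℂ) * Complex.I_mul_I
    rw [this, Complex.exp_zero, one_mul]
  intro b
  have hcl : (WeakDual.toStrongDual φ).comp (ContinuousLinearMap.mul ℂ A a)
      = (WeakDual.toStrongDual φ).comp
        ((ContinuousLinearMap.mul ℂ A).flip (F (Complex.I * β))) :=
    ContinuousLinearMap.ext_on hVd hMeq
  exact DFunLike.congr_fun hcl b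

lemma IsKMSZeroPlus.mem_states (h : IsKMSZeroPlus α φ) : φ ∈ states A := by
  obtain ⟨I, l, β, ψ, hl, -, hK, hψ⟩ := h
  exact isClosed_states.mem_of_tendsto hψ (Eventually.of_forall fun i => (hK i).1)

lemma tendsto_apply {I : Type*} {l : Filter I} {ψ : I → WeakDual ℂ A}
    (h : Tendsto ψ l (𝓝 φ)) (a : A) : Tendsto (fun i => ψ i a) l (𝓝 (φ a)) :=
  ((WeakDual.eval_continuous a).tendsto φ).comp h

lemma tendsto_exp_neg_mul {I : Type*} {l : Filter I} {β : I → ℝ} (h : Tendsto β l (𝓝[>] 0))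
    (c : ℝ) : Tendsto (fun i => Complex.exp (-(β i * c : ℝ))) l (𝓝 1) := by
  have h0 : Tendsto β l (𝓝 0) := h.mono_right nhdsWithin_le_nhds
  have hc : Continuous fun b : ℝ => Complex.exp (-(b * c : ℝ)) := by fun_prop
  have h1 := (hc.tendsto 0).comp h0
  simpa [Function.comp_def] using h1

/-- `KMS_{0⁺}` states are traces when eigenvectors generate. -/
lemma IsKMSZeroPlus.isTracial {G : Set A} (hG : Dense (StarAlgebra.adjoin ℂ G : Set A))
    (hE : ∀ g ∈ G, ∃ l, IsEigen α l g) (h : IsKMSZeroPlus α φ) : IsTracial φ := by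
  obtain ⟨I, l, β, ψ, hl, hβ, hK, hψ⟩ := h
  set M : Set A := {b | ∃ l : ℝ, IsEigen α l b} with hM
  have hMmul : ∀ x ∈ M, ∀ y ∈ M, x * y ∈ M := by
    rintro x ⟨l, hl⟩ y ⟨m, hm⟩
    exact ⟨l + m, hl.mul hm⟩
  have hMstar : ∀ x ∈ M, star x ∈ M := by
    rintro x ⟨l, hl⟩
    exact ⟨-l, hl.star⟩
  have hVd := dense_span_of_mul_mem hG (M := M) ⟨0, IsEigen.one⟩ hE hMmul hMstar
  intro a b
  -- Both sides are continuous in a, so eigenvectors suffice, and for them the factor e^{-βm} tends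
  -- to 1.
  have hcl : (WeakDual.toStrongDual φ).comp ((ContinuousLinearMap.mul ℂ A).flip b)
      = (WeakDual.toStrongDual φ).comp (ContinuousLinearMap.mul ℂ A b) := by
    refine ContinuousLinearMap.ext_on hVd ?_
    rintro x ⟨m, hm⟩
    have h1 := tendsto_apply hψ (x * b)
    have h2 := (tendsto_exp_neg_mul hβ m).mul (tendsto_apply hψ (b * x))
    rw [one_mul] at h2
    refine tendsto_nhds_unique h1 (h2.congr fun i => ?_)
    exact ((hK i).apply_eigen_mul hm b).symm
  exact DFunLike.congr_fun hcl a

end KMS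

/-! ### Adjoints of weighted shifts on the basis -/

section Basis

variable {ι κ : Type}

lemma inner_delta_left (q : ι → ℕ) (x : Ell2 ι) : inner ℂ (delta q) x = x q := by
  classical
  rw [delta, lp.inner_single_left]
  simp

lemma inner_delta_delta [DecidableEq (ι → ℕ)] (p q : ι → ℕ) :
    inner ℂ (delta p : Ell2 ι) (delta q) = if p = q then 1 else 0 :=
  orthonormal_iff_ite.1 orthonormal_delta p q

lemma ext_inner_delta {x y : Ell2 ι} (h : ∀ q, inner ℂ (delta q) x = inner ℂ (delta q) y) :
    x = y := by
  refine lp.ext (funext fun q => ?_)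
  rw [← inner_delta_left, h, inner_delta_left]

/-- Bounded operators on `ℓ²(ℕ^ι)` are determined by their values on the basis vectors. -/
lemma ext_delta' {E : Type*} [NormedAddCommGroup E] [NormedSpace ℂ E] {S T : Ell2 ι →L[ℂ] E}
    (h : ∀ q, S (delta q) = T (delta q)) : S = T := by
  classical
  refine ContinuousLinearMap.ext fun x => ?_
  have hx := lp.hasSum_single (p := 2) (by norm_num) x
  have hs : ∀ q, lp.single 2 q (x q) = (x q) • (delta q : Ell2 ι) := by
    intro q
    have : delta q = lp.single (E := fun _ : ι → ℕ => ℂ) 2 q (1 : ℂ) := by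
      rw [delta]
    rw [this, ← lp.single_smul]
    simp
  refine (hx.mapL S).unique ?_
  convert hx.mapL T using 2 with q
  rw [hs, map_smul, map_smul, h]

variable {T : Ell2 ι →L[ℂ] Ell2 κ} {c : (ι → ℕ) → Circle} {f : (ι → ℕ) → (κ → ℕ)}

lemma adjoint_delta_apply (hT : ∀ q, T (delta q) = (c q : ℂ) • delta (f q))
    (hf : Function.Injective f) (q : ι → ℕ) :
    ContinuousLinearMap.adjoint T (delta (f q)) = ((c q)⁻¹ : Circle) • (delta q : Ell2 ι) := by
  classical
  refine ext_inner_delta fun u => ?_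
  rw [ContinuousLinearMap.adjoint_inner_right, hT, inner_smul_left, inner_delta_delta,
    Circle.smul_def, inner_smul_right, inner_delta_delta, Circle.coe_inv_eq_conj]
  by_cases h : u = q
  · simp [h]
  · simp [h, hf.ne h]

lemma adjoint_delta_of_notMem (hT : ∀ q, T (delta q) = (c q : ℂ) • delta (f q))
    {u : κ → ℕ} (hu : u ∉ Set.range f) :
    ContinuousLinearMap.adjoint T (delta u) = 0 := by
  classical
  refine ext_inner_delta fun q => ?_
  rw [ContinuousLinearMap.adjoint_inner_right, hT, inner_smul_left, inner_delta_delta,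
    if_neg (fun h => hu ⟨q, h⟩), mul_zero, inner_zero_right]

end Basis

/-! ### The cocycle as an antisymmetric bicharacter -/

section Cocycle

variable {ι : Type} [Fintype ι] (Θ : Matrix ι ι ℝ)

lemma cocycle_add_left (p q s : ι → ℕ) :
    cocycle Θ (p + q) s = cocycle Θ p s * cocycle Θ q s := by
  have h : (fun j => (((p + q) j : ℕ) : ℝ)) = (fun j => (p j : ℝ)) + fun j => (q j : ℝ) := by
    funext j
    simp
  rw [cocycle, cocycle, cocycle, ← Circle.exp_add, h, add_dotProduct, mul_add]

lemma cocycle_add_right (p q s : ι → ℕ) :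
    cocycle Θ p (q + s) = cocycle Θ p q * cocycle Θ p s := by
  have h : (fun j => (((q + s) j : ℕ) : ℝ)) = (fun j => (q j : ℝ)) + fun j => (s j : ℝ) := by
    funext j
    simp
  rw [cocycle, cocycle, cocycle, ← Circle.exp_add, h, Matrix.mulVec_add, dotProduct_add, mul_add]

lemma cocycle_zero_left (p : ι → ℕ) : cocycle Θ 0 p = 1 := by
  have h := cocycle_add_left Θ 0 0 p
  rw [add_zero] at h
  simpa using h

variable {Θ}

lemma cocycle_swap (hΘ : Θ.transpose = -Θ) (p q : ι → ℕ) :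
    cocycle Θ q p = (cocycle Θ p q)⁻¹ := by
  rw [cocycle, cocycle, ← Circle.exp_neg]
  congr 1
  have h : (fun j => (q j : ℝ)) ⬝ᵥ Θ.mulVec (fun j => (p j : ℝ))
      = -((fun j => (p j : ℝ)) ⬝ᵥ Θ.mulVec (fun j => (q j : ℝ))) := by
    rw [Matrix.dotProduct_mulVec, ← Matrix.mulVec_transpose, hΘ, Matrix.neg_mulVec,
      neg_dotProduct, dotProduct_comm]
  rw [h]
  ring

variable (Θ)

/-- The commutation phase `e^{-2πi⟨p,Θq⟩}`, so that `L_p L_q = comm p q • L_q L_p`. -/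
def comm (p q : ι → ℕ) : Circle := cocycle Θ p q * cocycle Θ p q

end Cocycle

/-! ### Commutation relations and normal ordering of the generators -/

section Relations

variable {ι : Type}

lemma coe_gen (σ : (ι → ℕ) → (ι → ℕ) → Circle) (p : ι → ℕ) :
    (gen σ p : Ell2 ι →L[ℂ] Ell2 ι) = leftRegular σ p := rfl

lemma dense_gen (σ : (ι → ℕ) → (ι → ℕ) → Circle) :
    Dense (StarAlgebra.adjoin ℂ (Set.range (gen σ)) : Set (toeplitz σ)) :=
  dense_adjoin_preimage (leftRegular σ) _ rfl _ fun _ => rfl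

lemma star_leftRegular_add (σ : (ι → ℕ) → (ι → ℕ) → Circle) (p q : ι → ℕ) :
    star (leftRegular σ p) (delta (p + q)) = ((σ p q)⁻¹ : Circle) • (delta q : Ell2 ι) :=
  adjoint_delta_apply (leftRegular_delta σ p) (add_right_injective p) q

lemma star_leftRegular_of_not_le (σ : (ι → ℕ) → (ι → ℕ) → Circle) {p u : ι → ℕ}
    (h : ¬ p ≤ u) : star (leftRegular σ p) (delta u) = 0 :=
  adjoint_delta_of_notMem (leftRegular_delta σ p) fun ⟨_, hq⟩ => h (hq ▸ le_self_add)

lemma star_gen_mul_gen (σ : (ι → ℕ) → (ι → ℕ) → Circle) (p : ι → ℕ) :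
    star (gen σ p) * gen σ p = 1 := by
  refine Subtype.ext ?_
  change star (leftRegular σ p) * leftRegular σ p = 1
  exact (ContinuousLinearMap.norm_map_iff_adjoint_comp_self _).1
    (fun x => (weightedShift (σ p) (p + ·) (add_right_injective p)).norm_map x)

variable [Fintype ι] {Θ : Matrix ι ι ℝ}

lemma gen_zero : gen (cocycle Θ) 0 = 1 := by
  refine Subtype.ext (ext_delta fun q => ?_)
  change leftRegular (cocycle Θ) 0 (delta q) = delta q
  rw [leftRegular_delta, cocycle_zero_left, Circle.coe_one, one_smul, zero_add]

lemma gen_mul_gen (p q : ι → ℕ) :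
    gen (cocycle Θ) p * gen (cocycle Θ) q = (cocycle Θ p q : ℂ) • gen (cocycle Θ) (p + q) := by
  refine Subtype.ext (ext_delta fun s => ?_)
  rw [MulMemClass.coe_mul, SetLike.val_smul, coe_gen, coe_gen, coe_gen, mul_apply_eq_comp, smul_apply,
    leftRegular_delta, map_smul, leftRegular_delta, leftRegular_delta, smul_smul, smul_smul,
    add_assoc, ← Circle.coe_mul, ← Circle.coe_mul, cocycle_add_left, cocycle_add_right]
  congr 2
  rw [mul_comm, mul_assoc]

lemma gen_add (p q : ι → ℕ) :
    gen (cocycle Θ) (p + q)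
      = ((cocycle Θ p q)⁻¹ : Circle) • (gen (cocycle Θ) p * gen (cocycle Θ) q) := by
  rw [gen_mul_gen, ← Circle.smul_def, smul_smul, inv_mul_cancel, one_smul]

variable (hΘ : Θ.transpose = -Θ)
include hΘ

lemma gen_comm (p q : ι → ℕ) : gen (cocycle Θ) p * gen (cocycle Θ) q
    = comm Θ p q • (gen (cocycle Θ) q * gen (cocycle Θ) p) := by
  rw [gen_mul_gen, gen_mul_gen, ← Circle.smul_def, ← Circle.smul_def, smul_smul, add_comm q p,
    cocycle_swap hΘ p q, comm, mul_assoc, mul_inv_cancel, mul_one]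

/-- With disjoint supports, s ≤ x + q exactly when s ≤ q. So both sides vanish on the same basis
vectors and differ by a constant phase on the others. -/
lemma star_gen_mul_gen_of_disjoint {s x : ι → ℕ} (h : ∀ i, s i = 0 ∨ x i = 0) :
    star (gen (cocycle Θ) s) * gen (cocycle Θ) x
      = comm Θ x s • (gen (cocycle Θ) x * star (gen (cocycle Θ) s)) := by
  refine Subtype.ext (ext_delta fun q => ?_)
  rw [Circle.smul_def, MulMemClass.coe_mul, SetLike.val_smul, MulMemClass.coe_mul,
    StarMemClass.coe_star, coe_gen, coe_gen, mul_apply_eq_comp, smul_apply, mul_apply_eq_comp]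
  rw [leftRegular_delta, map_smul]
  by_cases hs : s ≤ q
  · obtain ⟨u, rfl⟩ := exists_add_of_le hs
    rw [add_left_comm x s u, star_leftRegular_add, star_leftRegular_add, Circle.smul_def,
      Circle.smul_def, map_smul, leftRegular_delta, smul_smul, smul_smul, smul_smul,
      ← Circle.coe_mul, ← Circle.coe_mul, ← Circle.coe_mul, comm]
    congr 2
    rw [cocycle_add_right, cocycle_add_right, cocycle_swap hΘ x s, mul_inv, inv_inv,
      mul_comm _ (cocycle Θ x u)]
    simp only [mul_assoc, mul_comm, mul_left_comm]
    rfl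
  · rw [star_leftRegular_of_not_le _ hs, star_leftRegular_of_not_le, map_zero, smul_zero,
      smul_zero]
    intro h2
    refine hs fun i => ?_
    have h3 : s i ≤ x i + q i := h2 i
    rcases h i with h4 | h4
    · exact h4.trans_le (Nat.zero_le _)
    · rwa [h4, zero_add] at h3

/-- With m = p ⊓ s split off from both exponents, L_m^* L_m = 1 cancels and disjoint supports
remain. -/
lemma exists_star_gen_mul_gen (s p : ι → ℕ) : ∃ c : Circle,
    star (gen (cocycle Θ) s) * gen (cocycle Θ) p
      = c • (gen (cocycle Θ) (p - p ⊓ s) * star (gen (cocycle Θ) (s - p ⊓ s))) := by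
  set m := p ⊓ s with hm
  have hp : p = m + (p - m) := (add_tsub_cancel_of_le inf_le_left).symm
  have hs : s = m + (s - m) := (add_tsub_cancel_of_le inf_le_right).symm
  have hd : ∀ i, (s - m) i = 0 ∨ (p - m) i = 0 := fun i => by
    rcases le_total (p i) (s i) with h | h
    · exact Or.inr (tsub_eq_zero_of_le (le_min le_rfl h))
    · exact Or.inl (tsub_eq_zero_of_le (le_min h le_rfl))
  have hp2 := gen_add (Θ := Θ) m (p - m)
  have hs2 := gen_add (Θ := Θ) m (s - m)
  rw [← hp] at hp2
  rw [← hs] at hs2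
  refine ⟨(cocycle Θ m (s - m)) * (cocycle Θ m (p - m))⁻¹ * comm Θ (p - m) (s - m), ?_⟩
  have h4 := star_gen_mul_gen_of_disjoint hΘ hd
  conv_lhs => rw [hp2, hs2]
  rw [mul_smul, ← h4, Circle.smul_def, Circle.smul_def, star_smul, smul_mul_smul_comm, star_mul,
    mul_assoc, ← mul_assoc (star (gen (cocycle Θ) m)), star_gen_mul_gen, one_mul,
    RCLike.star_def, ← Circle.coe_inv_eq_conj, inv_inv, Circle.smul_def, Circle.coe_mul]

/-- The products `L_p L_q^*` span a dense subspace. -/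
lemma dense_span_gen_mul_star : Dense (Submodule.span ℂ (Set.range fun pq : (ι → ℕ) × (ι → ℕ) =>
    gen (cocycle Θ) pq.1 * star (gen (cocycle Θ) pq.2)) : Set (toeplitz (cocycle Θ))) := by
  have hG := dense_gen (cocycle Θ)
  exact dense_span_range_mul_star hG gen_zero (fun p q => ⟨_, gen_mul_gen p q⟩) fun s p => by
    obtain ⟨c, hc⟩ := exists_star_gen_mul_gen hΘ s p
    exact ⟨c, _, _, hc⟩

end Relations

/-! ### Splitting ℕ^{k+d} into its two blocks -/

section Blocks

variable {k d : ℕ}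

lemma inl_add_inr (q : Fin (k + d) → ℕ) :
    inl (fun i => q (Fin.castAdd d i)) + inr (fun j => q (Fin.natAdd k j)) = q := by
  funext i
  refine Fin.addCases (fun i => ?_) (fun i => ?_) i <;> simp [inl, inr]

@[simp] lemma inl_castAdd (p : Fin k → ℕ) (i : Fin k) :
    inl (d := d) p (Fin.castAdd d i) = p i := by simp [inl]

@[simp] lemma inl_natAdd (p : Fin k → ℕ) (i : Fin d) :
    inl (d := d) p (Fin.natAdd k i) = 0 := by simp [inl]

@[simp] lemma inr_castAdd (p : Fin d → ℕ) (i : Fin k) :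
    inr (k := k) p (Fin.castAdd d i) = 0 := by simp [inr]

@[simp] lemma inr_natAdd (p : Fin d → ℕ) (i : Fin d) :
    inr (k := k) p (Fin.natAdd k i) = p i := by simp [inr]

lemma inl_add (p q : Fin k → ℕ) : inl (d := d) (p + q) = inl p + inl q := by
  funext i
  refine Fin.addCases (fun i => ?_) (fun i => ?_) i <;> simp

lemma inr_add (p q : Fin d → ℕ) : inr (k := k) (p + q) = inr p + inr q := by
  funext i
  refine Fin.addCases (fun i => ?_) (fun i => ?_) i <;> simp

lemma inl_zero : inl (0 : Fin k → ℕ) = (0 : Fin (k + d) → ℕ) := by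
  funext i
  refine Fin.addCases (fun i => ?_) (fun i => ?_) i <;> simp

lemma inr_injective : Function.Injective (inr : (Fin d → ℕ) → (Fin (k + d) → ℕ)) := by
  intro x y h
  funext i
  simpa using congrFun h (Fin.natAdd k i)

lemma inl_or_inr_eq_zero (p : Fin k → ℕ) (x : Fin d → ℕ) (i : Fin (k + d)) :
    inl (d := d) p i = 0 ∨ inr (k := k) x i = 0 := by
  refine Fin.addCases (fun i => ?_) (fun i => ?_) i <;> simp

variable {Θ : Matrix (Fin (k + d)) (Fin (k + d)) ℝ}

/-- The products `L_p L_x L_y^* L_q^*` with `p, q` in the first and `x, y` in the second block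
of coordinates. -/
def blockProd (Θ : Matrix (Fin (k + d)) (Fin (k + d)) ℝ) (p q : Fin k → ℕ) (x y : Fin d → ℕ) :
    toeplitz (cocycle Θ) :=
  gen (cocycle Θ) (inl p) * gen (cocycle Θ) (inr x) *
    star (gen (cocycle Θ) (inr y)) * star (gen (cocycle Θ) (inl q))

/-- The products `L_p L_x L_y^* L_q^*` span a dense subspace. -/
lemma dense_span_blockProd (hΘ : Θ.transpose = -Θ) :
    Dense (Submodule.span ℂ {a | ∃ p q x y, a = blockProd Θ p q x y} :
      Set (toeplitz (cocycle Θ))) := by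
  refine (dense_span_gen_mul_star hΘ).mono ?_
  refine Submodule.span_le.2 ?_
  rintro _ ⟨⟨u, v⟩, rfl⟩
  simp only
  have hu := gen_add (Θ := Θ) (inl fun i => u (Fin.castAdd d i)) (inr fun j => u (Fin.natAdd k j))
  have hv := gen_add (Θ := Θ) (inl fun i => v (Fin.castAdd d i)) (inr fun j => v (Fin.natAdd k j))
  rw [inl_add_inr] at hu hv
  rw [hu, hv, Circle.smul_def, Circle.smul_def, star_smul, smul_mul_smul_comm, star_mul]
  refine Submodule.smul_mem _ _ (Submodule.subset_span
    ⟨fun i => u (Fin.castAdd d i), fun i => v (Fin.castAdd d i), fun i => u (Fin.natAdd k i),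
      fun i => v (Fin.natAdd k i), ?_⟩)
  rw [blockProd, mul_assoc _ (star _) (star _)]

lemma cocycle_inr (x y : Fin d → ℕ) :
    cocycle Θ (inr x) (inr y) = cocycle (corner Θ) x y := by
  rw [cocycle, cocycle]
  congr 2
  simp [dotProduct, Matrix.mulVec, Fin.sum_univ_add, corner]

lemma corner_transpose (hΘ : Θ.transpose = -Θ) : (corner Θ).transpose = -corner Θ := by
  ext i j
  exact congrFun (congrFun hΘ (Fin.natAdd k i)) (Fin.natAdd k j)

end Blocks

/-! ### Right translations and their commutation with the left regular representation -/

section RightRegular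

variable {ι : Type} [Fintype ι] (Θ : Matrix ι ι ℝ)

/-- The operators `δ_q ↦ σ(q,s) δ_{s+q}` of the right regular representation. -/
def rightRegular (s : ι → ℕ) : Ell2 ι →L[ℂ] Ell2 ι :=
  (weightedShift (fun q => cocycle Θ q s) (s + ·) (add_right_injective s)).toContinuousLinearMap

lemma rightRegular_delta (s q : ι → ℕ) :
    rightRegular Θ s (delta q) = (cocycle Θ q s : ℂ) • delta (s + q) :=
  weightedShift_delta _ _ (add_right_injective s) q

/-- By bimultiplicativity both orders give the coefficient σ(p,q) σ(p,s) σ(q,s). -/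
lemma rightRegular_mul_leftRegular (s p : ι → ℕ) :
    rightRegular Θ s * leftRegular (cocycle Θ) p = leftRegular (cocycle Θ) p * rightRegular Θ s := by
  refine ext_delta fun q => ?_
  rw [mul_apply_eq_comp, mul_apply_eq_comp, leftRegular_delta, rightRegular_delta, map_smul,
    map_smul, leftRegular_delta, rightRegular_delta, smul_smul, smul_smul, add_left_comm s p q,
    ← Circle.coe_mul, ← Circle.coe_mul, cocycle_add_left, cocycle_add_right]
  congr 2
  rw [mul_comm (cocycle Θ p s), ← mul_assoc, mul_comm]
  rw [mul_comm (cocycle Θ p q), mul_comm, ← mul_assoc, mul_right_comm]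

/-- Disjoint supports are needed so that L_x^* annihilates δ_{s+q} exactly when it annihilates δ_q.
-/
lemma rightRegular_mul_star_leftRegular {s x : ι → ℕ} (h : ∀ i, s i = 0 ∨ x i = 0) :
    rightRegular Θ s * star (leftRegular (cocycle Θ) x)
      = star (leftRegular (cocycle Θ) x) * rightRegular Θ s := by
  refine ext_delta fun q => ?_
  rw [mul_apply_eq_comp, mul_apply_eq_comp, rightRegular_delta, map_smul]
  by_cases hx : x ≤ q
  · obtain ⟨u, rfl⟩ := exists_add_of_le hx
    rw [add_left_comm s x u, star_leftRegular_add, star_leftRegular_add, Circle.smul_def,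
      Circle.smul_def, map_smul, rightRegular_delta, smul_smul, smul_smul,
      ← Circle.coe_mul, ← Circle.coe_mul]
    congr 2
    rw [cocycle_add_right, cocycle_add_left, mul_inv]
    rw [mul_mul_mul_comm, mul_inv_cancel, one_mul, mul_comm]
  · rw [star_leftRegular_of_not_le _ hx, star_leftRegular_of_not_le, map_zero, smul_zero]
    intro h2
    refine hx fun i => ?_
    have h3 : x i ≤ s i + q i := h2 i
    rcases h i with h4 | h4
    · rwa [h4, zero_add] at h3
    · exact h4.trans_le (Nat.zero_le _)

end RightRegular

/-! ### Compression from ℓ²(ℕ^{k+d}) to ℓ²(ℕ^d) -/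

section Compression

variable {k d : ℕ}

variable (k d) in
/-- The inclusion `ℓ²(ℕ^d) → ℓ²(ℕ^{k+d})`, `δ_x ↦ δ_{(0,x)}`. -/
def blockIncl : Ell2 (Fin d) →L[ℂ] Ell2 (Fin (k + d)) :=
  (orthonormal_delta.comp (inr (k := k))
    inr_injective).orthogonalFamily.linearIsometry.toContinuousLinearMap

variable (k d) in
/-- The adjoint of the inclusion `ℓ²(ℕ^d) → ℓ²(ℕ^{k+d})`. -/
def blockProj : Ell2 (Fin (k + d)) →L[ℂ] Ell2 (Fin d) :=
  ContinuousLinearMap.adjoint (blockIncl k d)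

lemma blockIncl_delta (x : Fin d → ℕ) : blockIncl k d (delta x) = delta (inr x) := by
  classical
  have h := (orthonormal_delta.comp (inr (k := k) (d := d))
    inr_injective).orthogonalFamily.linearIsometry_apply_single (i := x) (1 : ℂ)
  change (orthonormal_delta.comp (inr (k := k)) inr_injective).orthogonalFamily.linearIsometry
    (delta x) = _
  rw [delta]
  convert h using 1
  · simp
  · exact (one_smul ℂ (delta (inr x) : Ell2 (Fin (k + d)))).symm

lemma blockProj_comp_blockIncl : blockProj k d ∘L blockIncl k d = 1 :=
  (ContinuousLinearMap.norm_map_iff_adjoint_comp_self _).1 (fun x =>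
    ((orthonormal_delta.comp (inr (k := k))
      inr_injective).orthogonalFamily.linearIsometry).norm_map x)

lemma adjoint_blockProj : ContinuousLinearMap.adjoint (blockProj k d) = blockIncl k d :=
  ContinuousLinearMap.adjoint_adjoint _

variable (Θ : Matrix (Fin (k + d)) (Fin (k + d)) ℝ)

lemma inr_le_inr {x y : Fin d → ℕ} : inr (k := k) x ≤ inr y ↔ x ≤ y := by
  refine ⟨fun h i => by simpa using h (Fin.natAdd k i), fun h i => ?_⟩
  refine Fin.addCases (fun i => ?_) (fun i => ?_) i
  · simp
  · simpa using h i

lemma inl_le_inl_add_inr {p s : Fin k → ℕ} {x : Fin d → ℕ} (h : inl (d := d) p ≤ inl s + inr x) :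
    p ≤ s := fun i => by simpa using h (Fin.castAdd d i)

lemma leftRegular_inr_comp_blockIncl (x : Fin d → ℕ) :
    leftRegular (cocycle Θ) (inr x) ∘L blockIncl k d
      = blockIncl k d ∘L leftRegular (cocycle (corner Θ)) x := by
  refine ext_delta' fun y => ?_
  rw [ContinuousLinearMap.comp_apply, ContinuousLinearMap.comp_apply, leftRegular_delta, map_smul,
    blockIncl_delta, blockIncl_delta, leftRegular_delta, cocycle_inr, inr_add]

lemma star_leftRegular_inr_comp_blockIncl (x : Fin d → ℕ) :
    star (leftRegular (cocycle Θ) (inr x)) ∘L blockIncl k d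
      = blockIncl k d ∘L star (leftRegular (cocycle (corner Θ)) x) := by
  refine ext_delta' fun y => ?_
  rw [ContinuousLinearMap.comp_apply, ContinuousLinearMap.comp_apply, blockIncl_delta]
  by_cases hx : x ≤ y
  · obtain ⟨u, rfl⟩ := exists_add_of_le hx
    rw [inr_add, star_leftRegular_add, star_leftRegular_add, Circle.smul_def, Circle.smul_def,
      map_smul, blockIncl_delta, cocycle_inr]
  · rw [star_leftRegular_of_not_le _ hx, star_leftRegular_of_not_le, map_zero]
    rwa [inr_le_inr]

lemma blockProj_comp_star_leftRegular_inr (x : Fin d → ℕ) :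
    blockProj k d ∘L star (leftRegular (cocycle Θ) (inr x))
      = star (leftRegular (cocycle (corner Θ)) x) ∘L blockProj k d := by
  have h := congrArg ContinuousLinearMap.adjoint (leftRegular_inr_comp_blockIncl Θ x)
  rwa [ContinuousLinearMap.adjoint_comp, ContinuousLinearMap.adjoint_comp] at h

lemma blockProj_comp_leftRegular_inr (x : Fin d → ℕ) :
    blockProj k d ∘L leftRegular (cocycle Θ) (inr x)
      = leftRegular (cocycle (corner Θ)) x ∘L blockProj k d := by
  have h := congrArg ContinuousLinearMap.adjoint (star_leftRegular_inr_comp_blockIncl Θ x)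
  rwa [ContinuousLinearMap.adjoint_comp, ContinuousLinearMap.adjoint_comp,
    ← ContinuousLinearMap.star_eq_adjoint, ← ContinuousLinearMap.star_eq_adjoint, star_star,
    star_star] at h

lemma star_leftRegular_inl_comp {p s : Fin k → ℕ} (h : ¬ p ≤ s) :
    star (leftRegular (cocycle Θ) (inl p)) ∘L leftRegular (cocycle Θ) (inl s) ∘L blockIncl k d
      = 0 := by
  refine ext_delta' fun x => ?_
  rw [ContinuousLinearMap.comp_apply, ContinuousLinearMap.comp_apply, blockIncl_delta,
    leftRegular_delta, map_smul, star_leftRegular_of_not_le _ fun h2 => h (inl_le_inl_add_inr h2),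
    smul_zero]
  rfl

lemma star_leftRegular_inl_comp_blockIncl {p : Fin k → ℕ} (h : p ≠ 0) :
    star (leftRegular (cocycle Θ) (inl p)) ∘L blockIncl k d = 0 := by
  refine ext_delta' fun x => ?_
  rw [ContinuousLinearMap.comp_apply, blockIncl_delta, star_leftRegular_of_not_le]
  · rfl
  · intro h2
    refine h (le_antisymm (fun i => ?_) (fun i => Nat.zero_le _))
    simpa using h2 (Fin.castAdd d i)

lemma blockProj_comp_leftRegular_inl {p : Fin k → ℕ} (h : p ≠ 0) :
    blockProj k d ∘L leftRegular (cocycle Θ) (inl p) = 0 := by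
  have h := congrArg ContinuousLinearMap.adjoint (star_leftRegular_inl_comp_blockIncl (d := d) Θ h)
  rwa [ContinuousLinearMap.adjoint_comp, ← ContinuousLinearMap.star_eq_adjoint, star_star,
    map_zero] at h

/-- The compression of operators on `ℓ²(ℕ^{k+d})` to `ℓ²(ℕ^d)`. -/
def compress : (Ell2 (Fin (k + d)) →L[ℂ] Ell2 (Fin (k + d))) →L[ℂ]
    (Ell2 (Fin d) →L[ℂ] Ell2 (Fin d)) :=
  (ContinuousLinearMap.compL ℂ _ _ _ (blockProj k d)).comp
    ((ContinuousLinearMap.compL ℂ _ _ _).flip (blockIncl k d))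

lemma compress_apply (a : Ell2 (Fin (k + d)) →L[ℂ] Ell2 (Fin (k + d))) :
    compress a = blockProj k d ∘L a ∘L blockIncl k d := rfl

variable {Θ}

/-- L_q^* with q ≠ 0 annihilates ℓ²(ℕ^d), and dually on the left. Only products of second-block
generators survive, which is why the compression lands in T_r(ℕ^d, σ_{Θ_d}). -/
lemma compress_blockProd (p q : Fin k → ℕ) (x y : Fin d → ℕ) :
    compress (blockProd Θ p q x y : Ell2 (Fin (k + d)) →L[ℂ] Ell2 (Fin (k + d)))
      = if p = 0 ∧ q = 0 then leftRegular (cocycle (corner Θ)) x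
          * star (leftRegular (cocycle (corner Θ)) y) else 0 := by
  rw [compress_apply, blockProd, MulMemClass.coe_mul, MulMemClass.coe_mul, MulMemClass.coe_mul,
    StarMemClass.coe_star, StarMemClass.coe_star, coe_gen, coe_gen, coe_gen, coe_gen]
  simp only [ContinuousLinearMap.mul_def]
  by_cases hp : p = 0
  · by_cases hq : q = 0
    · rw [if_pos ⟨hp, hq⟩, hp, hq, inl_zero]
      have h1 : leftRegular (cocycle Θ) 0 = 1 := congrArg Subtype.val (gen_zero (Θ := Θ))
      rw [h1, star_one]
      calc _ = blockProj k d ∘L leftRegular (cocycle Θ) (inr x) ∘L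
            (star (leftRegular (cocycle Θ) (inr y)) ∘L blockIncl k d) := rfl
        _ = (blockProj k d ∘L leftRegular (cocycle Θ) (inr x) ∘L blockIncl k d) ∘L
            star (leftRegular (cocycle (corner Θ)) y) := by
          rw [star_leftRegular_inr_comp_blockIncl]
          rfl
        _ = _ := by
          rw [leftRegular_inr_comp_blockIncl, ← ContinuousLinearMap.comp_assoc,
            blockProj_comp_blockIncl]
          rfl
    · rw [if_neg fun h => hq h.2]
      rw [ContinuousLinearMap.comp_assoc, star_leftRegular_inl_comp_blockIncl Θ hq,
        ContinuousLinearMap.comp_zero, ContinuousLinearMap.comp_zero]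
  · rw [if_neg fun h => hp h.1]
    simp only [← ContinuousLinearMap.comp_assoc]
    rw [blockProj_comp_leftRegular_inl Θ hp]
    simp only [ContinuousLinearMap.zero_comp]

lemma isClosed_toeplitz {ι : Type} (σ : (ι → ℕ) → (ι → ℕ) → Circle) :
    IsClosed (toeplitz σ : Set (Ell2 ι →L[ℂ] Ell2 ι)) :=
  StarSubalgebra.isClosed_topologicalClosure _

lemma compress_mem (hΘ : Θ.transpose = -Θ) (a : toeplitz (cocycle Θ)) :
    compress (a : Ell2 (Fin (k + d)) →L[ℂ] Ell2 (Fin (k + d))) ∈ toeplitz (cocycle (corner Θ)) := by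
  have hcl : IsClosed {a : toeplitz (cocycle Θ) |
      compress (a : Ell2 (Fin (k + d)) →L[ℂ] Ell2 (Fin (k + d))) ∈ toeplitz (cocycle (corner Θ))} :=
    (isClosed_toeplitz _).preimage (compress.continuous.comp continuous_subtype_val)
  refine hcl.closure_subset_iff.2 ?_ (dense_span_blockProd hΘ a)
  intro x hx
  induction hx using Submodule.span_induction with
  | mem x hx =>
    obtain ⟨p, q, x, y, rfl⟩ := hx
    rw [Set.mem_ofPred_eq, compress_blockProd]
    split_ifs
    · exact mul_mem (gen _ x).2 (star_mem (gen _ y).2)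
    · exact zero_mem _
  | zero => simp
  | add x y _ _ hx hy =>
    rw [Set.mem_ofPred_eq] at hx hy ⊢
    rw [AddMemClass.coe_add, map_add]
    exact add_mem hx hy
  | smul c x _ hx =>
    rw [Set.mem_ofPred_eq] at hx ⊢
    rw [SetLike.val_smul, map_smul]
    exact SMulMemClass.smul_mem c hx

/-- The compression as a map `T_r(ℕ^{k+d}, σ_Θ) → T_r(ℕ^d, σ_{Θ_d})`. -/
def expect (hΘ : Θ.transpose = -Θ) :
    toeplitz (cocycle Θ) →L[ℂ] toeplitz (cocycle (corner Θ)) where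
  toFun a := ⟨compress a.1, compress_mem hΘ a⟩
  map_add' a b := Subtype.ext (map_add compress a.1 b.1)
  map_smul' c a := Subtype.ext (map_smul compress c a.1)
  cont := (compress.continuous.comp continuous_subtype_val).subtype_mk _

variable (hΘ : Θ.transpose = -Θ)

lemma coe_expect (a : toeplitz (cocycle Θ)) :
    (expect hΘ a : Ell2 (Fin d) →L[ℂ] Ell2 (Fin d)) = blockProj k d ∘L a.1 ∘L blockIncl k d := rfl

lemma expect_one : expect hΘ 1 = 1 := Subtype.ext blockProj_comp_blockIncl

lemma expect_star (a : toeplitz (cocycle Θ)) : expect hΘ (star a) = star (expect hΘ a) := by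
  refine Subtype.ext ?_
  rw [StarMemClass.coe_star, coe_expect, coe_expect, StarMemClass.coe_star,
    ContinuousLinearMap.star_eq_adjoint, ContinuousLinearMap.star_eq_adjoint,
    ContinuousLinearMap.adjoint_comp, ContinuousLinearMap.adjoint_comp, adjoint_blockProj]
  rfl

/-- The inclusion intertwines L_{(0,x)} with L_x, so the compression is a module map over the second
block, though not multiplicative in general. -/
lemma expect_mul_gen_inr (a : toeplitz (cocycle Θ)) (x : Fin d → ℕ) :
    expect hΘ (a * gen _ (inr x)) = expect hΘ a * gen _ x := by
  refine Subtype.ext ?_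
  rw [MulMemClass.coe_mul, coe_expect, coe_expect, MulMemClass.coe_mul, coe_gen, coe_gen,
    ContinuousLinearMap.mul_def, ContinuousLinearMap.mul_def, ContinuousLinearMap.comp_assoc,
    leftRegular_inr_comp_blockIncl]
  rfl

lemma expect_gen_inr_mul (a : toeplitz (cocycle Θ)) (x : Fin d → ℕ) :
    expect hΘ (gen _ (inr x) * a) = gen _ x * expect hΘ a := by
  refine Subtype.ext ?_
  rw [MulMemClass.coe_mul, coe_expect, coe_expect, MulMemClass.coe_mul, coe_gen, coe_gen,
    ContinuousLinearMap.mul_def, ContinuousLinearMap.mul_def, ← ContinuousLinearMap.comp_assoc,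
    ← ContinuousLinearMap.comp_assoc, blockProj_comp_leftRegular_inr]
  rfl

lemma expect_gen_inr (x : Fin d → ℕ) : expect hΘ (gen _ (inr x)) = gen _ x := by
  have h := expect_mul_gen_inr hΘ 1 x
  rwa [expect_one, one_mul, one_mul] at h

/-- L_s sends ℓ²(ℕ^d) to vectors with first component s, which L_p^* annihilates unless p ≤ s. The
adjoint form removes terms from the Gibbs sum. -/
lemma expect_mul_star_gen_inl_mul {p s : Fin k → ℕ} (h : ¬ p ≤ s) (a : toeplitz (cocycle Θ)) :
    expect hΘ (a * (star (gen _ (inl p)) * gen _ (inl s))) = 0 := by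
  refine Subtype.ext ?_
  rw [coe_expect, MulMemClass.coe_mul, MulMemClass.coe_mul, StarMemClass.coe_star, coe_gen, coe_gen,
    ContinuousLinearMap.mul_def, ContinuousLinearMap.mul_def, ContinuousLinearMap.comp_assoc,
    ContinuousLinearMap.comp_assoc, star_leftRegular_inl_comp Θ h, ContinuousLinearMap.comp_zero,
    ContinuousLinearMap.comp_zero]
  rfl

lemma expect_star_gen_inl_mul {p s : Fin k → ℕ} (h : ¬ p ≤ s) (a : toeplitz (cocycle Θ)) :
    expect hΘ (star (gen _ (inl s)) * (gen _ (inl p) * a)) = 0 := by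
  have h1 := congrArg star (expect_mul_star_gen_inl_mul hΘ h (star a))
  rw [← expect_star, star_zero, star_mul, star_mul, star_star, star_star] at h1
  rwa [← mul_assoc]

end Compression

/-! ### The canonical isomorphism of T_r(ℕ^d, σ_{Θ_d}) onto C*(L_x) -/

section Iso

variable {k d : ℕ} {Θ : Matrix (Fin (k + d)) (Fin (k + d)) ℝ}

lemma isClosed_fixedBlock : IsClosed (fixedBlock Θ : Set (toeplitz (cocycle Θ))) :=
  StarSubalgebra.isClosed_topologicalClosure _

/-- An operator commuting with all `L_x` and `L_x^*`, `x ∈ 0_k × ℕ^d`, commutes with the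
C*-algebra they generate. -/
lemma fixedBlock_commute {T : Ell2 (Fin (k + d)) →L[ℂ] Ell2 (Fin (k + d))}
    (h : ∀ x : Fin d → ℕ, T * leftRegular (cocycle Θ) (inr x)
      = leftRegular (cocycle Θ) (inr x) * T)
    (h' : ∀ x : Fin d → ℕ, T * star (leftRegular (cocycle Θ) (inr x))
      = star (leftRegular (cocycle Θ) (inr x)) * T)
    {b : toeplitz (cocycle Θ)} (hb : b ∈ fixedBlock Θ) : T * b = b * T := by
  -- The centralizer as a *-subalgebra also requires commutation with T^*, which is the adjoint of
  -- `h'`.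
  set S : StarSubalgebra ℂ (toeplitz (cocycle Θ)) :=
    (StarSubalgebra.centralizer ℂ {T}).comap (toeplitz (cocycle Θ)).subtype with hS
  have hmem : ∀ b : toeplitz (cocycle Θ), b ∈ S ↔
      T * b = b * T ∧ star T * (b : Ell2 (Fin (k + d)) →L[ℂ] Ell2 (Fin (k + d))) = b * star T := by
    intro b
    rw [hS, StarSubalgebra.mem_comap, StarSubalgebra.mem_centralizer_iff]
    simp only [Set.mem_singleton_iff, forall_eq]
    rfl
  have hcl : IsClosed (S : Set (toeplitz (cocycle Θ))) := by
    have : (S : Set (toeplitz (cocycle Θ))) = {b : toeplitz (cocycle Θ) | T * b = b * T ∧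
        star T * (b : Ell2 (Fin (k + d)) →L[ℂ] Ell2 (Fin (k + d))) = b * star T} :=
      Set.ext hmem
    rw [this]
    exact (isClosed_eq (continuous_const.mul continuous_subtype_val)
      (continuous_subtype_val.mul continuous_const)).inter
      (isClosed_eq (continuous_const.mul continuous_subtype_val)
      (continuous_subtype_val.mul continuous_const))
  have hle : fixedBlock Θ ≤ S := by
    refine StarSubalgebra.topologicalClosure_minimal (StarAlgebra.adjoin_le ?_) hcl
    rintro _ ⟨x, rfl⟩
    refine (hmem _).2 ⟨h x, ?_⟩
    have := congrArg star (h' x)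
    rw [star_mul, star_mul, star_star] at this
    exact this.symm
  exact ((hmem b).1 (hle hb)).1

lemma fixedBlock_commute_rightRegular (s : Fin k → ℕ)
    {b : toeplitz (cocycle Θ)} (hb : b ∈ fixedBlock Θ) :
    rightRegular Θ (inl s) * b = b * rightRegular Θ (inl s) :=
  fixedBlock_commute (fun _ => rightRegular_mul_leftRegular Θ _ _)
    (fun x => rightRegular_mul_star_leftRegular Θ (inl_or_inr_eq_zero s x)) hb

/-- `blockIncl` ∘ `blockProj` is the projection onto ℓ²(ℕ^d); its commuting with C*(L_x) makes the
compression multiplicative there. -/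
lemma fixedBlock_commute_proj {b : toeplitz (cocycle Θ)} (hb : b ∈ fixedBlock Θ) :
    blockIncl k d ∘L blockProj k d ∘L b.1 = b.1 ∘L blockIncl k d ∘L blockProj k d := by
  refine fixedBlock_commute (T := blockIncl k d ∘L blockProj k d) (fun x => ?_) (fun x => ?_) hb
  · calc _ = blockIncl k d ∘L (blockProj k d ∘L leftRegular (cocycle Θ) (inr x)) := rfl
      _ = (blockIncl k d ∘L leftRegular (cocycle (corner Θ)) x) ∘L blockProj k d := by
        rw [blockProj_comp_leftRegular_inr]
        rfl
      _ = _ := by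
        rw [← leftRegular_inr_comp_blockIncl]
        rfl
  · calc _ = blockIncl k d ∘L (blockProj k d ∘L star (leftRegular (cocycle Θ) (inr x))) := rfl
      _ = (blockIncl k d ∘L star (leftRegular (cocycle (corner Θ)) x)) ∘L blockProj k d := by
        rw [blockProj_comp_star_leftRegular_inr]
        rfl
      _ = _ := by
        rw [← star_leftRegular_inr_comp_blockIncl]
        rfl

lemma fixedBlock_comp_blockIncl {b : toeplitz (cocycle Θ)} (hb : b ∈ fixedBlock Θ) :
    blockIncl k d ∘L blockProj k d ∘L b.1 ∘L blockIncl k d = b.1 ∘L blockIncl k d := by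
  calc _ = (blockIncl k d ∘L blockProj k d ∘L b.1) ∘L blockIncl k d := rfl
    _ = b.1 ∘L blockIncl k d ∘L (blockProj k d ∘L blockIncl k d) := by
      rw [fixedBlock_commute_proj hb]
      rfl
    _ = _ := by
      rw [blockProj_comp_blockIncl]
      rfl

lemma expect_mul_of_mem (hΘ : Θ.transpose = -Θ) (a : toeplitz (cocycle Θ))
    {b : toeplitz (cocycle Θ)} (hb : b ∈ fixedBlock Θ) :
    expect hΘ (a * b) = expect hΘ a * expect hΘ b := by
  refine Subtype.ext ?_
  calc _ = blockProj k d ∘L a.1 ∘L (b.1 ∘L blockIncl k d) := rfl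
    _ = _ := by
      rw [← fixedBlock_comp_blockIncl hb]
      rfl

/-- Up to a phase, δ_{(s,x)} is the right translate by s of δ_{(0,x)}. Since b commutes with right
translations, vanishing on ℓ²(ℕ^d) forces b = 0. -/
lemma eq_zero_of_expect_eq_zero (hΘ : Θ.transpose = -Θ)
    {b : toeplitz (cocycle Θ)} (hb : b ∈ fixedBlock Θ) (h : expect hΘ b = 0) : b = 0 := by
  have h1 : b.1 ∘L blockIncl k d = 0 := by
    have h2 : blockProj k d ∘L b.1 ∘L blockIncl k d = 0 := congrArg Subtype.val h
    rw [← fixedBlock_comp_blockIncl hb, h2, ContinuousLinearMap.comp_zero]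
  refine Subtype.ext (ext_delta fun q => ?_)
  set s : Fin k → ℕ := fun i => q (Fin.castAdd d i)
  set x : Fin d → ℕ := fun j => q (Fin.natAdd k j)
  have h3 := DFunLike.congr_fun (fixedBlock_commute_rightRegular s hb) (delta (inr x))
  rw [mul_apply_eq_comp, mul_apply_eq_comp, rightRegular_delta, map_smul, inl_add_inr] at h3
  have h4 : b.1 (delta (inr x)) = 0 := by
    rw [← blockIncl_delta]
    exact DFunLike.congr_fun h1 (delta x)
  rw [h4, map_zero] at h3
  have h5 := (smul_eq_zero.1 h3.symm).resolve_left (Circle.coe_ne_zero _)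
  rw [h5]
  rfl

/-- The compression is a `*`-homomorphism on `C*(L_x : x ∈ 0_k × ℕ^d)`. -/
def expectHom (hΘ : Θ.transpose = -Θ) : fixedBlock Θ →⋆ₐ[ℂ] toeplitz (cocycle (corner Θ)) where
  toFun b := expect hΘ b.1
  map_one' := expect_one hΘ
  map_mul' a b := expect_mul_of_mem hΘ a.1 b.2
  map_zero' := map_zero (expect hΘ)
  map_add' a b := map_add (expect hΘ) a.1 b.1
  commutes' c := by
    rw [Algebra.algebraMap_eq_smul_one, Algebra.algebraMap_eq_smul_one]
    change expect hΘ (c • 1) = c • 1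
    rw [map_smul, expect_one]
  map_star' a := expect_star hΘ a.1

lemma expectHom_injective (hΘ : Θ.transpose = -Θ) : Function.Injective (expectHom hΘ) := by
  rw [injective_iff_map_eq_zero]
  exact fun b hb => Subtype.ext (eq_zero_of_expect_eq_zero hΘ b.2 hb)

lemma expectHom_isometry (hΘ : Θ.transpose = -Θ) : Isometry (expectHom hΘ) := by
  let _ : CStarAlgebra (toeplitz (cocycle (corner Θ))) :=
    StarSubalgebra.cstarAlgebra _ (h_closed := isClosed_toeplitz _)
  let _ : CStarAlgebra (toeplitz (cocycle Θ)) :=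
    StarSubalgebra.cstarAlgebra _ (h_closed := isClosed_toeplitz _)
  let _ : CStarAlgebra (fixedBlock Θ) :=
    StarSubalgebra.cstarAlgebra (fixedBlock Θ) (h_closed := isClosed_fixedBlock)
  exact NonUnitalStarAlgHom.isometry (expectHom hΘ) (expectHom_injective hΘ)

/-- The isometric image of a complete space is closed, and it contains the generators. -/
lemma expectHom_surjective (hΘ : Θ.transpose = -Θ) : Function.Surjective (expectHom hΘ) := by
  have : CompleteSpace (toeplitz (cocycle Θ)) := (isClosed_toeplitz _).completeSpace_coe
  have : CompleteSpace (fixedBlock Θ) := isClosed_fixedBlock.completeSpace_coe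
  have hcl : IsClosed (Set.range (expectHom hΘ)) :=
    (expectHom_isometry hΘ).isClosedEmbedding.isClosed_range
  have hle : StarAlgebra.adjoin ℂ (Set.range (gen (cocycle (corner Θ)))) ≤ (expectHom hΘ).range := by
    refine StarAlgebra.adjoin_le ?_
    rintro _ ⟨x, rfl⟩
    exact ⟨fixedGen Θ x, expect_gen_inr hΘ x⟩
  intro a
  have ha := dense_gen (cocycle (corner Θ)) a
  exact hcl.closure_subset_iff.2 hle ha

/-- The canonical isomorphism of `T_r(ℕ^d, σ_{Θ_d})` onto `C*(L_x : x ∈ 0_k × ℕ^d)`. -/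
def blockEquiv (hΘ : Θ.transpose = -Θ) : toeplitz (cocycle (corner Θ)) ≃⋆ₐ[ℂ] fixedBlock Θ :=
  (StarAlgEquiv.ofBijective (expectHom hΘ)
    ⟨expectHom_injective hΘ, expectHom_surjective hΘ⟩).symm

lemma expectHom_blockEquiv (hΘ : Θ.transpose = -Θ) (a : toeplitz (cocycle (corner Θ))) :
    expectHom hΘ (blockEquiv hΘ a) = a :=
  (StarAlgEquiv.ofBijective (expectHom hΘ)
    ⟨expectHom_injective hΘ, expectHom_surjective hΘ⟩).apply_symm_apply a

lemma blockEquiv_gen (hΘ : Θ.transpose = -Θ) (x : Fin d → ℕ) :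
    blockEquiv hΘ (gen (cocycle (corner Θ)) x) = fixedGen Θ x :=
  expectHom_injective hΘ ((expectHom_blockEquiv hΘ _).trans (expect_gen_inr hΘ x).symm)

lemma blockEquiv_isometry (hΘ : Θ.transpose = -Θ) : Isometry (blockEquiv hΘ) :=
  (expectHom_isometry hΘ).right_inv (expectHom_blockEquiv hΘ)

/-- The inclusion `T_r(ℕ^d, σ_{Θ_d}) → T_r(ℕ^{k+d}, σ_Θ)`. -/
def blockMap (hΘ : Θ.transpose = -Θ) : toeplitz (cocycle (corner Θ)) →L[ℂ] toeplitz (cocycle Θ) where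
  toFun a := (blockEquiv hΘ a).1
  map_add' a b := congrArg Subtype.val (map_add (blockEquiv hΘ) a b)
  map_smul' c a := congrArg Subtype.val (map_smul (blockEquiv hΘ) c a)
  cont := continuous_subtype_val.comp (blockEquiv_isometry hΘ).continuous

lemma blockMap_mul (hΘ : Θ.transpose = -Θ) (a b : toeplitz (cocycle (corner Θ))) :
    blockMap hΘ (a * b) = blockMap hΘ a * blockMap hΘ b :=
  congrArg Subtype.val (map_mul (blockEquiv hΘ) a b)

lemma blockMap_star (hΘ : Θ.transpose = -Θ) (a : toeplitz (cocycle (corner Θ))) :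
    blockMap hΘ (star a) = star (blockMap hΘ a) :=
  congrArg Subtype.val ((blockEquiv hΘ).map_star' a)

lemma blockMap_one (hΘ : Θ.transpose = -Θ) : blockMap hΘ 1 = 1 :=
  congrArg Subtype.val (map_one (blockEquiv hΘ))

lemma blockMap_gen (hΘ : Θ.transpose = -Θ) (x : Fin d → ℕ) :
    blockMap hΘ (gen (cocycle (corner Θ)) x) = gen (cocycle Θ) (inr x) :=
  congrArg Subtype.val (blockEquiv_gen hΘ x)

end Iso

/-! ### Countable mixtures and isometric conjugates of states -/

section ConvexCombination

variable {A : Type*} [NormedRing A] [NormedAlgebra ℂ A] [StarRing A] [StarModule ℂ A] [CStarRing A]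

/-- Countable convex combinations of states. -/
lemma exists_states_hasSum {S : Type*} {w : S → ℝ} (hw : ∀ s, 0 ≤ w s) (hw1 : HasSum w 1)
    {ψ : S → WeakDual ℂ A} (hψ : ∀ s, ψ s ∈ states A) :
    ∃ φ ∈ states A, ∀ a, HasSum (fun s => (w s : ℂ) * ψ s a) (φ a) := by
  have hsum : Summable fun s => (w s : ℂ) • WeakDual.toStrongDual (ψ s) := by
    refine Summable.of_norm_bounded hw1.summable fun s => ?_
    refine ContinuousLinearMap.opNorm_le_bound _ (hw s) fun a => ?_
    have h := states_norm_le (hψ s) a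
    calc ‖(w s : ℂ) * ψ s a‖ = w s * ‖ψ s a‖ := by
          rw [norm_mul, Complex.norm_real, Real.norm_of_nonneg (hw s)]
      _ ≤ w s * ‖a‖ := mul_le_mul_of_nonneg_left h (hw s)
  set φ : WeakDual ℂ A :=
    StrongDual.toWeakDual (∑' s, (w s : ℂ) • WeakDual.toStrongDual (ψ s)) with hφ
  have hev : ∀ a, HasSum (fun s => (w s : ℂ) * ψ s a) (φ a) := fun a =>
    hsum.hasSum.mapL (ContinuousLinearMap.apply ℂ ℂ a)
  refine ⟨φ, ⟨?_, fun a => ?_⟩, hev⟩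
  · have h1 := hev 1
    simp only [(hψ _).1, mul_one] at h1
    have h2 := Complex.hasSum_ofReal.2 hw1
    rw [Complex.ofReal_one] at h2
    exact h1.unique h2
  · exact (hev (star a * a)).nonneg fun s =>
      mul_nonneg (by exact_mod_cast hw s) ((hψ s).2 a)

/-- The state `a ↦ ω(L^* a L)` for an isometry `L`. -/
lemma exists_states_conj {ω : WeakDual ℂ A} (hω : ω ∈ states A) {L : A} (hL : star L * L = 1) :
    ∃ ψ ∈ states A, ∀ a, ψ a = ω (star L * a * L) := by
  refine ⟨StrongDual.toWeakDual ((WeakDual.toStrongDual ω).comp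
    (((ContinuousLinearMap.mul ℂ A).flip L).comp (ContinuousLinearMap.mul ℂ A (star L)))),
    ⟨?_, fun a => ?_⟩, fun a => rfl⟩
  · change ω (star L * 1 * L) = 1
    rw [mul_one, hL, hω.1]
  · change 0 ≤ ω (star L * (star a * a) * L)
    have h := hω.2 (a * L)
    rwa [star_mul, mul_assoc, ← mul_assoc (star a), ← mul_assoc] at h

end ConvexCombination

lemma summable_prod_pow {k : ℕ} {x : Fin k → ℝ} (h0 : ∀ i, 0 ≤ x i) (h1 : ∀ i, x i < 1) :
    Summable fun s : Fin k → ℕ => ∏ i, x i ^ s i := by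
  induction k with
  | zero => exact Summable.of_finite
  | succ k ih =>
    rw [← (Fin.consEquiv fun _ => ℕ).summable_iff]
    have h := (summable_geometric_of_lt_one (h0 0) (h1 0)).mul_of_nonneg
      (ih (fun i => h0 i.succ) (fun i => h1 i.succ)) (fun n => pow_nonneg (h0 0) n)
      (fun s => Finset.prod_nonneg fun i _ => pow_nonneg (h0 i.succ) _)
    refine h.congr fun s => ?_
    rw [Function.comp_apply, Fin.prod_univ_succ]
    simp [Fin.consEquiv]

/-! ### Commutation phases and the integrality condition -/

section Phases

variable {ι : Type} [Fintype ι] {Θ : Matrix ι ι ℝ}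

/-- Antisymmetry moves Θ to the first argument: -⟨p,Θs⟩ = ⟨Θp,s⟩. -/
lemma comm_mul_inv (hΘ : Θ.transpose = -Θ) (p q s : ι → ℕ) :
    comm Θ p s * (comm Θ q s)⁻¹ = Circle.exp (2 * Real.pi *
      ∑ j, Θ.mulVec (fun i => (p i : ℝ) - (q i : ℝ)) j * s j) := by
  have h : ∀ p : ι → ℕ, comm Θ p s
      = Circle.exp (2 * Real.pi * (Θ.mulVec (fun i => (p i : ℝ)) ⬝ᵥ fun j => (s j : ℝ))) := by
    intro p
    rw [comm, cocycle, ← Circle.exp_add]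
    congr 1
    rw [Matrix.dotProduct_mulVec, ← Matrix.mulVec_transpose, hΘ, Matrix.neg_mulVec,
      neg_dotProduct]
    ring
  rw [h, h, ← Circle.exp_neg, ← Circle.exp_add]
  congr 1
  have h2 : (fun i => (p i : ℝ) - (q i : ℝ)) = (fun i => (p i : ℝ)) - fun i => (q i : ℝ) := rfl
  rw [h2, Matrix.mulVec_sub]
  change _ = 2 * Real.pi * ((Θ.mulVec (fun i => (p i : ℝ)) - Θ.mulVec fun i => (q i : ℝ)) ⬝ᵥ
    fun j => (s j : ℝ))
  rw [sub_dotProduct]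
  ring

end Phases

section Integral

variable {k d : ℕ} {Θ : Matrix (Fin (k + d)) (Fin (k + d)) ℝ}

lemma circle_exp_eq_one_iff (x : ℝ) : Circle.exp (2 * Real.pi * x) = 1 ↔ ∃ m : ℤ, x = m := by
  rw [Circle.exp_eq_one]
  refine exists_congr fun m => ?_
  rw [mul_comm, mul_left_inj' Real.two_pi_pos.ne']

lemma comm_mul_inv_eq_one (hΘ : Θ.transpose = -Θ) {x y : Fin d → ℕ}
    (h : IsIntegralDiff Θ x y) (s : Fin (k + d) → ℕ) :
    comm Θ (inr x) s * (comm Θ (inr y) s)⁻¹ = 1 := by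
  rw [comm_mul_inv hΘ, circle_exp_eq_one_iff]
  choose m hm using h
  exact ⟨∑ j, m j * s j, by push_cast; exact Finset.sum_congr rfl fun j _ => by rw [hm j]⟩

lemma isIntegralDiff_of_comm (hΘ : Θ.transpose = -Θ) {x y : Fin d → ℕ}
    (h : ∀ s, comm Θ (inr (k := k) x) s * (comm Θ (inr y) s)⁻¹ = 1) : IsIntegralDiff Θ x y := by
  intro j
  -- Taking s = e_j isolates the j-th coordinate of Θ(x-y).
  have hj := h (Pi.single j 1)
  rw [comm_mul_inv hΘ, circle_exp_eq_one_iff] at hj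
  obtain ⟨m, hm⟩ := hj
  refine ⟨m, ?_⟩
  rw [← hm, Finset.sum_eq_single j]
  · simp
  · intro i _ hi
    simp [hi]
  · simp

end Integral

/-! ### Positivity of τ ∘ E -/

section Positivity

variable {ι : Type}

/-- A state of a Toeplitz algebra is nonnegative on its elements that are positive operators. -/
lemma states_nonneg_of_nonneg {σ : (ι → ℕ) → (ι → ℕ) → Circle} {τ : WeakDual ℂ (toeplitz σ)}
    (hτ : τ ∈ states (toeplitz σ)) {h : toeplitz σ} (h0 : 0 ≤ (h : Ell2 ι →L[ℂ] Ell2 ι)) :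
    0 ≤ τ h := by
  have hsa : IsSelfAdjoint (h : Ell2 ι →L[ℂ] Ell2 ι) := IsSelfAdjoint.of_nonneg h0
  have hstar : star h = h := Subtype.ext hsa
  -- For positive h, ‖h‖·1 - h has norm at most ‖h‖. Contractivity places τ(h) within ‖h‖ of ‖h‖, so
  -- its real part is nonnegative; no square root inside the algebra is needed.
  have hn : ‖((‖h‖ : ℂ) • (1 : toeplitz σ)) - h‖ ≤ ‖h‖ := by
    change ‖((‖h‖ : ℂ) • (1 : Ell2 ι →L[ℂ] Ell2 ι)) - h‖ ≤ ‖h‖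
    have h1 : (h : Ell2 ι →L[ℂ] Ell2 ι) ≤ (‖h‖ : ℂ) • (1 : Ell2 ι →L[ℂ] Ell2 ι) := by
      have := hsa.le_algebraMap_norm_self
      rwa [Algebra.algebraMap_eq_smul_one] at this
    have h2 : (0 : Ell2 ι →L[ℂ] Ell2 ι) ≤ (‖h‖ : ℂ) • (1 : Ell2 ι →L[ℂ] Ell2 ι) - h :=
      sub_nonneg.2 h1
    rw [CStarAlgebra.norm_le_iff_le_algebraMap _ (norm_nonneg h) h2,
      Algebra.algebraMap_eq_smul_one]
    exact sub_le_self _ h0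
  have h3 := (states_norm_le hτ _).trans hn
  rw [map_sub, map_smul, hτ.1, smul_eq_mul, mul_one] at h3
  have him : (τ h).im = 0 := by
    have h4 := states_map_star hτ h
    rw [hstar] at h4
    exact Complex.conj_eq_iff_im.1 h4.symm
  have hre := (Complex.abs_re_le_norm _).trans h3
  rw [Complex.sub_re, Complex.ofReal_re, abs_le] at hre
  exact Complex.le_def.2 ⟨by simp; linarith, by simp [him]⟩

end Positivity

section VacuumExtension

variable {k d : ℕ} {Θ : Matrix (Fin (k + d)) (Fin (k + d)) ℝ}

/-- The functional `τ ∘ E` on `T_r(ℕ^{k+d}, σ_Θ)`, with `E` the compression to `ℓ²(ℕ^d)`. -/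
def vacuumExt (hΘ : Θ.transpose = -Θ) (τ : WeakDual ℂ (toeplitz (cocycle (corner Θ)))) :
    WeakDual ℂ (toeplitz (cocycle Θ)) :=
  StrongDual.toWeakDual ((WeakDual.toStrongDual τ).comp (expect hΘ))

lemma vacuumExt_apply (hΘ : Θ.transpose = -Θ) (τ : WeakDual ℂ (toeplitz (cocycle (corner Θ))))
    (a : toeplitz (cocycle Θ)) : vacuumExt hΘ τ a = τ (expect hΘ a) := rfl

lemma vacuumExt_mem_states (hΘ : Θ.transpose = -Θ) {τ : WeakDual ℂ (toeplitz (cocycle (corner Θ)))}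
    (hτ : τ ∈ states (toeplitz (cocycle (corner Θ)))) :
    vacuumExt hΘ τ ∈ states (toeplitz (cocycle Θ)) := by
  refine ⟨?_, fun a => ?_⟩
  · rw [vacuumExt_apply, expect_one, hτ.1]
  · rw [vacuumExt_apply]
    -- E(a^* a) is a positive operator, but its factor a ∘ `blockIncl` maps between two spaces and
    -- is not in the algebra, so the defining inequality of a state does not apply directly.
    refine states_nonneg_of_nonneg hτ ?_
    have h : (expect hΘ (star a * a) : Ell2 (Fin d) →L[ℂ] Ell2 (Fin d))
        = ContinuousLinearMap.adjoint (a.1 ∘L blockIncl k d) ∘L (a.1 ∘L blockIncl k d) := by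
      rw [ContinuousLinearMap.adjoint_comp]
      rfl
    rw [h, ContinuousLinearMap.nonneg_iff_isPositive]
    exact ContinuousLinearMap.isPositive_adjoint_comp_self _

lemma vacuumExt_mul_gen_inr (hΘ : Θ.transpose = -Θ)
    {τ : WeakDual ℂ (toeplitz (cocycle (corner Θ)))} (hτ : IsTracial τ)
    (a : toeplitz (cocycle Θ)) (x : Fin d → ℕ) :
    vacuumExt hΘ τ (a * gen _ (inr x)) = vacuumExt hΘ τ (gen _ (inr x) * a) := by
  rw [vacuumExt_apply, vacuumExt_apply, expect_mul_gen_inr, expect_gen_inr_mul, hτ]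

end VacuumExtension

/-! ### Algebraic identities for the Gibbs sum -/

section Dynamics

variable {ι : Type} [Fintype ι]

lemma isEigen_gen (σ : (ι → ℕ) → (ι → ℕ) → Circle) (r : ι → ℝ) (p : ι → ℕ) :
    IsEigen (dynamics σ r) (∑ j, (p j : ℝ) * r j) (gen σ p) := fun t => by
  rw [dynamics_gen, phase, Circle.coe_exp]
  congr 2
  push_cast
  ring

/-- L_{p+s} is a phase times L_p L_s, so L_p^* L_p = 1 cancels and the phases are conjugate. This
shift s ↦ p + s turns the terms of φ(L_p a) into those of φ(a L_p). -/
lemma star_gen_add_mul_gen_mul {ι : Type} [Fintype ι] {Θ : Matrix ι ι ℝ} (p s : ι → ℕ)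
    (a : toeplitz (cocycle Θ)) :
    star (gen (cocycle Θ) (p + s)) * (gen (cocycle Θ) p * a) * gen (cocycle Θ) (p + s)
      = star (gen (cocycle Θ) s) * (a * gen (cocycle Θ) p) * gen (cocycle Θ) s := by
  have h : star (((cocycle Θ p s)⁻¹ : Circle) : ℂ) * (((cocycle Θ p s)⁻¹ : Circle) : ℂ) = 1 := by
    rw [RCLike.star_def, ← Circle.coe_inv_eq_conj, ← Circle.coe_mul, inv_mul_cancel, Circle.coe_one]
  rw [gen_add, Circle.smul_def, star_smul, smul_mul_assoc, smul_mul_smul_comm, h, one_smul,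
    star_mul, mul_assoc (star (gen _ s)), ← mul_assoc (star (gen _ p)), star_gen_mul_gen, one_mul,
    mul_assoc, mul_assoc, mul_assoc]

lemma eq_of_hasSum_eq {S : Type*} {f g : S → ℂ} {a b : ℂ} (hf : HasSum f a) (hg : HasSum g b)
    (h : ∀ s, f s = g s) : a = b := by
  obtain rfl : f = g := funext h
  exact hf.unique hg

end Dynamics

section Phases

variable {A : Type*} [Ring A] [Algebra ℂ A] {c : Circle} {x s t : A}

lemma mul_mul_mul_of_smul_comm (h : x * s = c • (s * x)) (t a : A) :
    t * (a * x) * s = c • (t * a * s * x) := by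
  rw [mul_assoc, mul_assoc a, h, Circle.smul_def, Circle.smul_def, mul_smul_comm, mul_smul_comm,
    ← mul_assoc a, ← mul_assoc t, mul_assoc t a s]

lemma mul_mul_mul_of_smul_comm' (h : t * x = c • (x * t)) (s a : A) :
    t * (x * a) * s = c • (x * (t * a * s)) := by
  rw [← mul_assoc t, h, Circle.smul_def, Circle.smul_def, smul_mul_assoc, smul_mul_assoc, mul_assoc,
    mul_assoc, mul_assoc]

end Phases

section Factors

variable {A : Type*} [NormedRing A] [NormedAlgebra ℂ A] {φ : WeakDual ℂ A}

lemma apply_mul_eq_of_factors {c : Circle} {q x y : A} {e w : ℂ} (hq : q = c • (x * y))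
    (hy : ∀ a, φ (a * y) = φ (y * a)) (hx : ∀ a, φ (x * a) = w * φ (a * x)) (h : e * w = 1)
    (a : A) : φ (a * q) = e * φ (q * a) := by
  rw [hq, Circle.smul_def, mul_smul_comm, smul_mul_assoc, map_smul, map_smul, ← mul_assoc, hy,
    ← mul_assoc, mul_assoc x, hx, smul_eq_mul, smul_eq_mul, mul_left_comm e, ← mul_assoc e, h,
    one_mul]

end Factors

/-! ### Gibbs states extending a given trace -/

section Gibbs

variable {k d : ℕ} {Θ : Matrix (Fin (k + d)) (Fin (k + d)) ℝ} {r : Fin (k + d) → ℝ}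

lemma sum_inl_mul (r : Fin (k + d) → ℝ) (p : Fin k → ℕ) :
    ∑ j, (inl (d := d) p j : ℝ) * r j = ∑ i, (p i : ℝ) * r (Fin.castAdd d i) := by
  rw [Fin.sum_univ_add]
  simp

lemma sum_inr_mul (hr_zero : ∀ j : Fin d, r (Fin.natAdd k j) = 0) (x : Fin d → ℕ) :
    ∑ j, (inr (k := k) x j : ℝ) * r j = 0 := by
  rw [Fin.sum_univ_add]
  simp [hr_zero]

/-- The Boltzmann weight `e^{-β⟨s,r⟩}` of `s ∈ ℕ^k`. -/
def boltzmann (r : Fin (k + d) → ℝ) (β : ℝ) (s : Fin k → ℕ) : ℝ :=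
  Real.exp (-(β * ∑ i, (s i : ℝ) * r (Fin.castAdd d i)))

lemma boltzmann_add (β : ℝ) (p s : Fin k → ℕ) :
    boltzmann r β (p + s) = boltzmann r β p * boltzmann r β s := by
  rw [boltzmann, boltzmann, boltzmann, ← Real.exp_add]
  congr 1
  simp only [Pi.add_apply, Nat.cast_add, add_mul, Finset.sum_add_distrib]
  ring

lemma boltzmann_pos (β : ℝ) (s : Fin k → ℕ) : 0 < boltzmann r β s := Real.exp_pos _

lemma summable_boltzmann (hr_pos : ∀ i : Fin k, 0 < r (Fin.castAdd d i)) {β : ℝ} (hβ : 0 < β) :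
    Summable (boltzmann r β) := by
  refine (summable_prod_pow (x := fun i => Real.exp (-(β * r (Fin.castAdd d i))))
    (fun i => (Real.exp_pos _).le)
    (fun i => Real.exp_lt_one_iff.2 (by simpa using mul_pos hβ (hr_pos i)))).congr fun s => ?_
  rw [boltzmann, Finset.mul_sum, ← Finset.sum_neg_distrib, Real.exp_sum]
  refine Finset.prod_congr rfl fun i _ => ?_
  rw [← Real.exp_nat_mul]
  congr 1
  ring

lemma diagOp_comp_blockIncl (hr_zero : ∀ j : Fin d, r (Fin.natAdd k j) = 0) (t : ℝ) :
    diagOp r t ∘L blockIncl k d = blockIncl k d := by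
  refine ext_delta' fun x => ?_
  rw [ContinuousLinearMap.comp_apply, blockIncl_delta, diagOp_delta, phase,
    sum_inr_mul hr_zero, zero_mul, Circle.exp_zero, Circle.coe_one, one_smul]

lemma expect_dynamics (hΘ : Θ.transpose = -Θ) (hr_zero : ∀ j : Fin d, r (Fin.natAdd k j) = 0)
    (t : ℝ) (a : toeplitz (cocycle Θ)) :
    expect hΘ (dynamics (cocycle Θ) r t a) = expect hΘ a := by
  refine Subtype.ext ?_
  have h1 : blockProj k d ∘L diagOp r t = blockProj k d := by
    have h := congrArg ContinuousLinearMap.adjoint (diagOp_comp_blockIncl hr_zero (-t))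
    rwa [ContinuousLinearMap.adjoint_comp, ← ContinuousLinearMap.star_eq_adjoint (diagOp r (-t)),
      star_diagOp, neg_neg] at h
  calc _ = (blockProj k d ∘L diagOp r t) ∘L a.1 ∘L (star (diagOp r t) ∘L blockIncl k d) := rfl
    _ = _ := by
      rw [h1, star_diagOp, diagOp_comp_blockIncl hr_zero]
      rfl

lemma star_gen_mul_dynamics_mul_gen (σ : (Fin (k + d) → ℕ) → (Fin (k + d) → ℕ) → Circle)
    (s : Fin (k + d) → ℕ) (t : ℝ) (a : toeplitz σ) :
    star (gen σ s) * dynamics σ r t a * gen σ s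
      = dynamics σ r t (star (gen σ s) * a * gen σ s) := by
  have h : star ((phase r t s : Circle) : ℂ) * (phase r t s : ℂ) = 1 := by
    rw [RCLike.star_def, ← Circle.coe_inv_eq_conj, ← Circle.coe_mul, inv_mul_cancel, Circle.coe_one]
  have hs : dynamics σ r t (star (gen σ s)) = star (dynamics σ r t (gen σ s)) :=
    (dynamics σ r t).map_star' _
  rw [map_mul, map_mul, hs, dynamics_gen, star_smul, smul_mul_assoc, smul_mul_smul_comm, h,
    one_smul]

variable (hΘ : Θ.transpose = -Θ)
include hΘ

/-- The functionals `a ↦ τ(E(L_s^* a L_s))` are states. -/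
lemma exists_translate {τ : WeakDual ℂ (toeplitz (cocycle (corner Θ)))}
    (hτ : τ ∈ states (toeplitz (cocycle (corner Θ)))) :
    ∃ ψ : (Fin k → ℕ) → WeakDual ℂ (toeplitz (cocycle Θ)),
      (∀ s, ψ s ∈ states (toeplitz (cocycle Θ))) ∧
      ∀ s a, ψ s a = vacuumExt hΘ τ
        (star (gen (cocycle Θ) (inl s)) * a * gen (cocycle Θ) (inl s)) := by
  choose ψ h1 h2 using fun s : Fin k → ℕ =>
    exists_states_conj (vacuumExt_mem_states hΘ hτ) (star_gen_mul_gen (cocycle Θ) (inl s))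
  exact ⟨ψ, h1, h2⟩

lemma gen_inr_mul_gen_inl (x : Fin d → ℕ) (s : Fin k → ℕ) :
    gen (cocycle Θ) (inr x) * gen (cocycle Θ) (inl s)
      = comm Θ (inr x) (inl s) • (gen (cocycle Θ) (inl s) * gen (cocycle Θ) (inr x)) :=
  gen_comm hΘ _ _

lemma star_gen_inl_mul_gen_inr (x : Fin d → ℕ) (s : Fin k → ℕ) :
    star (gen (cocycle Θ) (inl s)) * gen (cocycle Θ) (inr x)
      = comm Θ (inr x) (inl s) • (gen (cocycle Θ) (inr x) * star (gen (cocycle Θ) (inl s))) :=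
  star_gen_mul_gen_of_disjoint hΘ (inl_or_inr_eq_zero s x)

/-- Passing L_x across L_s on one side and across L_s^* on the other costs the same phase, so the
trace property of τ carries over. -/
lemma translate_mul_gen_inr {τ : WeakDual ℂ (toeplitz (cocycle (corner Θ)))} (hτ : IsTracial τ)
    (s : Fin k → ℕ) (x : Fin d → ℕ) (a : toeplitz (cocycle Θ)) :
    vacuumExt hΘ τ (star (gen (cocycle Θ) (inl s)) * (a * gen (cocycle Θ) (inr x)) *
        gen (cocycle Θ) (inl s))
      = vacuumExt hΘ τ (star (gen (cocycle Θ) (inl s)) * (gen (cocycle Θ) (inr x) * a) *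
        gen (cocycle Θ) (inl s)) := by
  have h1 := mul_mul_mul_of_smul_comm (gen_inr_mul_gen_inl hΘ x s)
    (star (gen (cocycle Θ) (inl s))) a
  have h2 := mul_mul_mul_of_smul_comm' (star_gen_inl_mul_gen_inr hΘ x s)
    (gen (cocycle Θ) (inl s)) a
  rw [h1, h2, Circle.smul_def, Circle.smul_def, map_smul, map_smul, vacuumExt_mul_gen_inr hΘ hτ]

lemma translate_dynamics (hr_zero : ∀ j : Fin d, r (Fin.natAdd k j) = 0)
    (τ : WeakDual ℂ (toeplitz (cocycle (corner Θ)))) (s : Fin k → ℕ) (t : ℝ)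
    (a : toeplitz (cocycle Θ)) :
    vacuumExt hΘ τ (star (gen (cocycle Θ) (inl s)) * dynamics (cocycle Θ) r t a *
        gen (cocycle Θ) (inl s))
      = vacuumExt hΘ τ (star (gen (cocycle Θ) (inl s)) * a * gen (cocycle Θ) (inl s)) := by
  have h := star_gen_mul_dynamics_mul_gen (r := r) (cocycle Θ) (inl s) t a
  have h2 := expect_dynamics hΘ hr_zero t
    (star (gen (cocycle Θ) (inl s)) * a * gen (cocycle Θ) (inl s))
  rw [vacuumExt_apply, vacuumExt_apply, h, h2]

lemma translate_gen_inl_mul_of_not_le {τ : WeakDual ℂ (toeplitz (cocycle (corner Θ)))}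
    {p s : Fin k → ℕ} (h : ¬ p ≤ s) (a : toeplitz (cocycle Θ)) :
    vacuumExt hΘ τ (star (gen (cocycle Θ) (inl s)) * (gen (cocycle Θ) (inl p) * a) *
        gen (cocycle Θ) (inl s)) = 0 := by
  rw [vacuumExt_apply, mul_assoc, mul_assoc (gen _ _), expect_star_gen_inl_mul hΘ h, map_zero]

/-- Conjugation by L_s multiplies L_x L_y^* by e^{2πi⟨Θ(x-y),s⟩}. Either this is 1 by integrality,
or τ vanishes on the element; so every translate restricts to τ. -/
lemma translate_gen_inr_mul_star {τ : WeakDual ℂ (toeplitz (cocycle (corner Θ)))}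
    (hτ : τ ∈ plusTraces Θ) (s : Fin k → ℕ) (x y : Fin d → ℕ) :
    vacuumExt hΘ τ (star (gen (cocycle Θ) (inl s)) *
        (gen (cocycle Θ) (inr x) * star (gen (cocycle Θ) (inr y))) * gen (cocycle Θ) (inl s))
      = τ (gen (cocycle (corner Θ)) x * star (gen (cocycle (corner Θ)) y)) := by
  have hy := congrArg star (star_gen_inl_mul_gen_inr hΘ y s)
  rw [Circle.smul_def, star_smul, star_mul, star_mul, star_star, RCLike.star_def,
    ← Circle.coe_inv_eq_conj] at hy
  have hE : expect hΘ (gen (cocycle Θ) (inr x) * star (gen (cocycle Θ) (inr y)))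
      = gen (cocycle (corner Θ)) x * star (gen (cocycle (corner Θ)) y) := by
    rw [expect_gen_inr_mul, expect_star, expect_gen_inr]
  have hE2 : star (gen (cocycle Θ) (inl s)) *
        (gen (cocycle Θ) (inr x) * star (gen (cocycle Θ) (inr y))) * gen (cocycle Θ) (inl s)
      = ((comm Θ (inr x) (inl s) * (comm Θ (inr y) (inl s))⁻¹ : Circle) : ℂ) •
        (gen (cocycle Θ) (inr x) * star (gen (cocycle Θ) (inr y))) := by
    rw [← mul_assoc, star_gen_inl_mul_gen_inr hΘ, mul_assoc, hy, Circle.smul_def,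
      smul_mul_smul_comm, mul_assoc, ← mul_assoc (star (gen _ (inl s))), star_gen_mul_gen, one_mul,
      Circle.coe_mul]
  rw [hE2, map_smul, vacuumExt_apply, hE]
  by_cases h : IsIntegralDiff Θ x y
  · rw [comm_mul_inv_eq_one hΘ h, Circle.coe_one, one_smul]
  · rw [hτ.2.2 x y h, smul_zero]

/-- Existence of `KMS_β` states with prescribed restriction to the fixed block. -/
lemma exists_isKMS (hr_pos : ∀ i : Fin k, 0 < r (Fin.castAdd d i))
    (hr_zero : ∀ j : Fin d, r (Fin.natAdd k j) = 0) {β : ℝ} (hβ : 0 < β)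
    {τ : WeakDual ℂ (toeplitz (cocycle (corner Θ)))} (hτ : τ ∈ plusTraces Θ) :
    ∃ φ : WeakDual ℂ (toeplitz (cocycle Θ)), IsKMS (dynamics (cocycle Θ) r) β φ ∧
      ∀ x y : Fin d → ℕ, φ (gen (cocycle Θ) (inr x) * star (gen (cocycle Θ) (inr y)))
        = τ (gen (cocycle (corner Θ)) x * star (gen (cocycle (corner Θ)) y)) := by
  obtain ⟨ψ, hψ, hψa⟩ := exists_translate hΘ hτ.1
  have hsum := summable_boltzmann hr_pos hβ
  set Z := ∑' s, boltzmann r β s with hZ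
  have hZpos : 0 < Z := hsum.tsum_pos (fun s => (boltzmann_pos β s).le) 0 (boltzmann_pos β 0)
  have hw : ∀ s : Fin k → ℕ, 0 ≤ boltzmann r β s / Z :=
    fun s => div_nonneg (boltzmann_pos β s).le hZpos.le
  have hw1 : HasSum (fun s : Fin k → ℕ => boltzmann r β s / Z) 1 := by
    have h := hsum.hasSum.div_const Z
    rwa [div_self hZpos.ne'] at h
  -- The Gibbs state: the mean of the translates a ↦ τ(E(L_s^* a L_s)) with normalised Boltzmann
  -- weights.
  obtain ⟨φ, hφ, hφa⟩ := exists_states_hasSum hw hw1 hψ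
  have hinr : ∀ (x : Fin d → ℕ) a, φ (a * gen _ (inr x)) = φ (gen _ (inr x) * a) := by
    intro x a
    refine eq_of_hasSum_eq (hφa _) (hφa _) fun s => ?_
    rw [hψa, hψa, translate_mul_gen_inr hΘ hτ.2.1]
  have hinl : ∀ (p : Fin k → ℕ) a,
      φ (gen _ (inl p) * a) = boltzmann r β p * φ (a * gen _ (inl p)) := by
    intro p a
    have h1 := hφa (gen _ (inl p) * a)
    -- Only indices of the form p + s contribute to φ(L_p a); reindexing by s extracts the weight of
    -- p.
    rw [← (add_right_injective p).hasSum_iff] at h1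
    · refine eq_of_hasSum_eq h1 ((hφa (a * gen _ (inl p))).mul_left _) fun s => ?_
      rw [Function.comp_apply, hψa, hψa, inl_add, star_gen_add_mul_gen_mul, boltzmann_add]
      push_cast
      ring
    · intro s hs
      rw [hψa, translate_gen_inl_mul_of_not_le, mul_zero]
      exact fun h => hs ⟨s - p, add_tsub_cancel_of_le h⟩
  have hG := dense_gen (cocycle Θ)
  refine ⟨φ, isKMS_of_eigen hG hφ (fun t a => ?_) ?_, fun x y => ?_⟩
  · refine eq_of_hasSum_eq (hφa (dynamics (cocycle Θ) r t a)) (hφa a) fun s => ?_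
    have h := translate_dynamics hΘ hr_zero τ s t a
    rw [← hψa, ← hψa] at h
    rw [h]
  · rintro _ ⟨q, rfl⟩
    refine ⟨_, isEigen_gen _ r q, fun a => ?_⟩
    have hq := gen_add (Θ := Θ) (inl fun i => q (Fin.castAdd d i))
      (inr fun j => q (Fin.natAdd k j))
    have hl : ∑ j, (q j : ℝ) * r j
        = ∑ i, (q (Fin.castAdd d i) : ℝ) * r (Fin.castAdd d i) := by
      rw [Fin.sum_univ_add]
      simp [hr_zero]
    rw [inl_add_inr] at hq
    refine apply_mul_eq_of_factors hq (hinr _) (hinl _) ?_ a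
    rw [hl, boltzmann, Complex.ofReal_exp, ← Complex.exp_add, ← Complex.ofReal_add, add_neg_cancel,
      Complex.ofReal_zero, Complex.exp_zero]
  · have h1 := hφa (gen (cocycle Θ) (inr x) * star (gen (cocycle Θ) (inr y)))
    simp only [hψa, translate_gen_inr_mul_star hΘ hτ] at h1
    have h2 := Complex.hasSum_ofReal.2 hw1
    rw [Complex.ofReal_one] at h2
    have h3 := h2.mul_right (τ (gen (cocycle (corner Θ)) x * star (gen (cocycle (corner Θ)) y)))
    rw [one_mul] at h3
    exact h1.unique h3

end Gibbs

/-! ### Values of KMS_β and KMS_{0⁺} states on the spanning products -/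

section Forward

variable {k d : ℕ} {Θ : Matrix (Fin (k + d)) (Fin (k + d)) ℝ} {r : Fin (k + d) → ℝ}

section Factors

variable {A : Type*} [NormedRing A] [NormedAlgebra ℂ A] {φ : WeakDual ℂ A}

/-- If `φ` has the KMS property with a factor `e < 1` for `p`, and `X`, `q` commute with `p` up to
phases, then `φ(p X q) = 0`. -/
lemma apply_eq_zero_of_factor {p X q : A} {e : ℝ} {c₁ c₂ : Circle} (he0 : 0 ≤ e) (he : e < 1)
    (hp : ∀ a, φ (p * a) = e * φ (a * p)) (hX : X * p = c₁ • (p * X)) (hq : q * p = c₂ • (p * q)) :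
    φ (p * X * q) = 0 := by
  -- Cycling p once and commuting it back past q and X reproduces the value times e and two phases.
  -- Taking norms leaves a nonnegative number equal to e times itself, with e < 1.
  have h1 : φ (p * X * q) = e * ((c₂ : ℂ) * ((c₁ : ℂ) * φ (p * X * q))) := by
    conv_lhs => rw [mul_assoc, hp, mul_assoc, hq, Circle.smul_def, mul_smul_comm, map_smul,
      ← mul_assoc, hX, Circle.smul_def, smul_mul_assoc, map_smul, smul_eq_mul, smul_eq_mul]
  have h2 := congrArg norm h1
  rw [norm_mul, norm_mul, norm_mul, Circle.norm_coe, Circle.norm_coe, one_mul, one_mul,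
    Complex.norm_real, Real.norm_of_nonneg he0] at h2
  rw [← norm_eq_zero]
  nlinarith [norm_nonneg (φ (p * X * q))]

lemma apply_mul_smul_eq_zero {X u v : A} {c c' : Circle} (hX : X * u = c' • (u * X))
    (h : φ (u * X * v) = 0) : φ (X * (c • (u * v))) = 0 := by
  rw [Circle.smul_def, mul_smul_comm, map_smul, ← mul_assoc, hX, Circle.smul_def, smul_mul_assoc,
    map_smul, h, smul_zero, smul_zero]

end Factors

lemma boltzmann_lt_one (hr_pos : ∀ i : Fin k, 0 < r (Fin.castAdd d i)) {β : ℝ} (hβ : 0 < β)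
    {p : Fin k → ℕ} (hp : p ≠ 0) : boltzmann r β p < 1 := by
  rw [boltzmann, Real.exp_lt_one_iff, neg_lt_zero]
  refine mul_pos hβ ?_
  obtain ⟨i, hi⟩ := Function.ne_iff.1 hp
  refine Finset.sum_pos' (fun i _ => mul_nonneg (Nat.cast_nonneg _) (hr_pos i).le)
    ⟨i, Finset.mem_univ _, mul_pos (Nat.cast_pos.2 (Nat.pos_of_ne_zero hi)) (hr_pos i)⟩

lemma IsKMS.gen_inl_mul {β : ℝ} {φ : WeakDual ℂ (toeplitz (cocycle Θ))}
    (h : IsKMS (dynamics (cocycle Θ) r) β φ) (p : Fin k → ℕ) (a : toeplitz (cocycle Θ)) :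
    φ (gen (cocycle Θ) (inl p) * a) = boltzmann r β p * φ (a * gen (cocycle Θ) (inl p)) := by
  rw [h.apply_eigen_mul (isEigen_gen (cocycle Θ) r (inl p)) a, sum_inl_mul, boltzmann,
    Complex.ofReal_exp, Complex.ofReal_neg]

variable (hΘ : Θ.transpose = -Θ)
include hΘ

lemma exists_block_mul_gen_inl (p : Fin k → ℕ) (x y : Fin d → ℕ) : ∃ c : Circle,
    gen (cocycle Θ) (inr x) * star (gen (cocycle Θ) (inr y)) * gen (cocycle Θ) (inl p)
      = c • (gen (cocycle Θ) (inl p) *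
        (gen (cocycle Θ) (inr x) * star (gen (cocycle Θ) (inr y)))) := by
  have h1 := star_gen_mul_gen_of_disjoint hΘ (s := inr (k := k) y) (x := inl p)
    fun i => (inl_or_inr_eq_zero p y i).symm
  refine ⟨comm Θ (inl p) (inr y) * comm Θ (inr x) (inl p), ?_⟩
  rw [mul_assoc, h1, Circle.smul_def, mul_smul_comm, ← mul_assoc, gen_inr_mul_gen_inl hΘ,
    Circle.smul_def, smul_mul_assoc, smul_smul, Circle.smul_def, Circle.coe_mul, mul_assoc]

/-- Disjointness lets L_q^* commute with L_p up to a phase, and p ≠ 0 makes the Boltzmann factor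
less than 1. -/
lemma IsKMS.blockProd_eq_zero_of_disjoint (hr_pos : ∀ i : Fin k, 0 < r (Fin.castAdd d i)) {β : ℝ}
    (hβ : 0 < β) {φ : WeakDual ℂ (toeplitz (cocycle Θ))}
    (h : IsKMS (dynamics (cocycle Θ) r) β φ) {p q : Fin k → ℕ} (hp : p ≠ 0)
    (hpq : ∀ i, q i = 0 ∨ p i = 0) (x y : Fin d → ℕ) : φ (blockProd Θ p q x y) = 0 := by
  obtain ⟨c, hc⟩ := exists_block_mul_gen_inl hΘ p x y
  have hd : ∀ i, inl (d := d) q i = 0 ∨ inl (d := d) p i = 0 := by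
    intro i
    refine Fin.addCases (fun i => ?_) (fun i => ?_) i
    · simpa using hpq i
    · simp
  have hq := star_gen_mul_gen_of_disjoint hΘ hd
  rw [blockProd, mul_assoc (gen _ (inl p))]
  exact apply_eq_zero_of_factor (boltzmann_pos β p).le (boltzmann_lt_one hr_pos hβ hp)
    (h.gen_inl_mul p) hc hq

omit hΘ in
lemma star_blockProd (p q : Fin k → ℕ) (x y : Fin d → ℕ) :
    star (blockProd Θ p q x y) = blockProd Θ q p y x := by
  simp only [blockProd, star_mul, star_star, mul_assoc]

omit hΘ in
lemma inl_sub_inf (p q : Fin k → ℕ) :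
    inl (d := d) p - inl (d := d) p ⊓ inl q = inl (p - p ⊓ q) := by
  funext i
  refine Fin.addCases (fun i => ?_) (fun i => ?_) i
  · rw [Pi.sub_apply, Pi.inf_apply, inl_castAdd, inl_castAdd, inl_castAdd]
    rfl
  · rw [Pi.sub_apply, inl_natAdd, inl_natAdd, Nat.zero_sub]

set_option maxHeartbeats 800000 in
/-- The values of `KMS_β` states, `β > 0`, on the spanning elements. -/
lemma IsKMS.apply_blockProd (hr_pos : ∀ i : Fin k, 0 < r (Fin.castAdd d i)) {β : ℝ}
    (hβ : 0 < β) {φ : WeakDual ℂ (toeplitz (cocycle Θ))}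
    (h : IsKMS (dynamics (cocycle Θ) r) β φ) (p q : Fin k → ℕ) (x y : Fin d → ℕ) :
    φ (blockProd Θ p q x y) = if p = q then
      boltzmann r β p * φ (gen (cocycle Θ) (inr x) * star (gen (cocycle Θ) (inr y))) else 0 := by
  -- Moving L_p to the right end brings it next to L_q^*, where the common part of p and q cancels.
  have h1 : φ (blockProd Θ p q x y) = boltzmann r β p *
      φ (gen (cocycle Θ) (inr x) * star (gen (cocycle Θ) (inr y)) *
        (star (gen (cocycle Θ) (inl q)) * gen (cocycle Θ) (inl p))) := by
    rw [blockProd, mul_assoc, mul_assoc, h.gen_inl_mul, mul_assoc, mul_assoc, mul_assoc]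
  split_ifs with hpq
  · rw [h1, hpq, star_gen_mul_gen, mul_one]
  · obtain ⟨c, hc⟩ := exists_star_gen_mul_gen hΘ (inl (d := d) q) (inl p)
    rw [inf_comm, inl_sub_inf q p, inf_comm (inl q), inl_sub_inf p q] at hc
    set p' := p - p ⊓ q with hp'
    set q' := q - q ⊓ p with hq'
    have hd : ∀ i, q' i = 0 ∨ p' i = 0 := fun i => by
      rcases le_total (p i) (q i) with h | h
      · exact Or.inr (tsub_eq_zero_of_le (le_min le_rfl h))
      · exact Or.inl (tsub_eq_zero_of_le (le_min le_rfl h))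
    have h0 : φ (blockProd Θ p' q' x y) = 0 := by
      -- If p' = 0 then q' ≠ 0, as p ≠ q; taking adjoints exchanges their roles.
      by_cases hp0 : p' = 0
      · have hq0 : q' ≠ 0 := by
          intro hq0
          have h2 : p ≤ q := (tsub_eq_zero_iff_le.1 hp0).trans inf_le_right
          have h3 : q ≤ p := (tsub_eq_zero_iff_le.1 hq0).trans inf_le_right
          exact hpq (le_antisymm h2 h3)
        rw [← star_blockProd, states_map_star h.1,
          h.blockProd_eq_zero_of_disjoint hΘ hr_pos hβ hq0 fun i => (hd i).symm, star_zero]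
      · exact h.blockProd_eq_zero_of_disjoint hΘ hr_pos hβ hp0 hd x y
    obtain ⟨c', hc'⟩ := exists_block_mul_gen_inl hΘ p' x y
    have h2 : blockProd Θ p' q' x y = gen (cocycle Θ) (inl p') *
        (gen (cocycle Θ) (inr x) * star (gen (cocycle Θ) (inr y))) *
        star (gen (cocycle Θ) (inl q')) := by
      rw [blockProd, mul_assoc (gen _ (inl p'))]
    rw [h2] at h0
    have h3 := apply_mul_smul_eq_zero (c := c) hc' h0
    rw [h1, (congrArg (fun z => φ (gen (cocycle Θ) (inr x) * star (gen (cocycle Θ) (inr y)) * z))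
      hc).trans h3, mul_zero]

/-- The values of `KMS_{0⁺}` states on the spanning elements. -/
lemma IsKMSZeroPlus.apply_blockProd (hr_pos : ∀ i : Fin k, 0 < r (Fin.castAdd d i))
    {φ : WeakDual ℂ (toeplitz (cocycle Θ))} (h : IsKMSZeroPlus (dynamics (cocycle Θ) r) φ)
    (p q : Fin k → ℕ) (x y : Fin d → ℕ) :
    φ (blockProd Θ p q x y) = if p = q then
      φ (gen (cocycle Θ) (inr x) * star (gen (cocycle Θ) (inr y))) else 0 := by
  obtain ⟨I, l, β, ψ, hl, hβ, hK, hψ⟩ := h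
  -- Convergence from the right gives β > 0 eventually, as the formula for KMS_β states requires.
  have hpos : ∀ᶠ i in l, 0 < β i := hβ.eventually self_mem_nhdsWithin
  have h1 := tendsto_apply hψ (blockProd Θ p q x y)
  refine tendsto_nhds_unique (h1.congr' (hpos.mono fun i hi =>
    (hK i).apply_blockProd hΘ hr_pos hi p q x y)) ?_
  split_ifs with hpq
  · have h2 := (tendsto_exp_neg_mul hβ (∑ i, (p i : ℝ) * r (Fin.castAdd d i))).mul
      (tendsto_apply hψ (gen (cocycle Θ) (inr x) * star (gen (cocycle Θ) (inr y))))
    rw [one_mul] at h2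
    refine h2.congr fun i => ?_
    rw [boltzmann, Complex.ofReal_exp, Complex.ofReal_neg]
  · exact tendsto_const_nhds

omit hΘ in
lemma IsKMSZeroPlus.tracial {φ : WeakDual ℂ (toeplitz (cocycle Θ))}
    (h : IsKMSZeroPlus (dynamics (cocycle Θ) r) φ) : IsTracial φ := by
  have hG := dense_gen (cocycle Θ)
  refine IsKMSZeroPlus.isTracial hG ?_ h
  rintro _ ⟨p, rfl⟩
  exact ⟨_, isEigen_gen _ r p⟩

end Forward

/-! ### Restriction of traces, extension of traces, and the characterisation -/

section Traces

/-- The trace property gives φ(XY^*) = φ(L X Y^* L^*). Pulling L and L^* inwards produces the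
phases, and the projection L L^* left in the middle is invisible to φ. -/
lemma tracial_apply_eq_of_isometry {A : Type*} [NormedRing A] [NormedAlgebra ℂ A] [StarRing A]
    [StarModule ℂ A] {φ : WeakDual ℂ A} (hφ : φ ∈ states A) (ht : IsTracial φ) {L X Y : A}
    (hL : star L * L = 1) {c₁ c₂ : Circle} (hX : L * X = c₁ • (X * L)) (hY : L * Y = c₂ • (Y * L)) :
    φ (X * star Y) = ((c₁ * c₂⁻¹ : Circle) : ℂ) * φ (X * star Y) := by
  have hY' : star Y * star L = c₂⁻¹ • (star L * star Y) := by
    rw [← star_mul, hY, Circle.smul_def, star_smul, star_mul, RCLike.star_def,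
      ← Circle.coe_inv_eq_conj, Circle.smul_def]
  have h1 : φ (X * star Y) = φ (L * X * (star Y * star L)) := by
    rw [← mul_assoc, ht _ (star L), ← mul_assoc, ← mul_assoc, hL, one_mul]
  conv_lhs => rw [h1, hX, hY', Circle.smul_def, Circle.smul_def, smul_mul_smul_comm, map_smul,
    ← mul_assoc, mul_assoc X, ht, ← mul_assoc, mul_assoc, ← mul_assoc,
    tracial_mul_isometry hφ ht hL, ht]
  rw [Circle.coe_mul, smul_eq_mul]

variable {k d : ℕ} {Θ : Matrix (Fin (k + d)) (Fin (k + d)) ℝ} (hΘ : Θ.transpose = -Θ)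
include hΘ

/-- A nonzero value forces the commutation phase with L_s to be 1 for every s, from either block,
hence integrality in all coordinates. -/
lemma tracial_apply_eq_zero {φ : WeakDual ℂ (toeplitz (cocycle Θ))}
    (hφ : φ ∈ states (toeplitz (cocycle Θ))) (ht : IsTracial φ) {x y : Fin d → ℕ}
    (h : ¬ IsIntegralDiff Θ x y) :
    φ (gen (cocycle Θ) (inr x) * star (gen (cocycle Θ) (inr y))) = 0 := by
  by_contra h0
  refine h (isIntegralDiff_of_comm hΘ fun s => ?_)
  have h1 := tracial_apply_eq_of_isometry hφ ht (star_gen_mul_gen (cocycle Θ) s)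
    (gen_comm hΘ s (inr x)) (gen_comm hΘ s (inr y))
  have h2 : ((comm Θ s (inr x) * (comm Θ s (inr y))⁻¹ : Circle) : ℂ) = 1 :=
    mul_right_cancel₀ h0 (h1.symm.trans (one_mul _).symm)
  have h3 : comm Θ s (inr x) * (comm Θ s (inr y))⁻¹ = 1 :=
    Circle.ext (h2.trans Circle.coe_one.symm)
  have hs : ∀ p, comm Θ p s = (comm Θ s p)⁻¹ := fun p => by
    rw [comm, comm, cocycle_swap hΘ s p, mul_inv]
  rw [hs, hs, inv_inv, ← inv_eq_one, mul_inv, inv_inv]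
  exact h3

/-- The restriction of functionals to the fixed block. -/
def restrict (φ : WeakDual ℂ (toeplitz (cocycle Θ))) :
    WeakDual ℂ (toeplitz (cocycle (corner Θ))) :=
  StrongDual.toWeakDual ((WeakDual.toStrongDual φ).comp (blockMap hΘ))

lemma restrict_apply (φ : WeakDual ℂ (toeplitz (cocycle Θ)))
    (a : toeplitz (cocycle (corner Θ))) : restrict hΘ φ a = φ (blockMap hΘ a) := rfl

lemma restrict_gen_mul_star (φ : WeakDual ℂ (toeplitz (cocycle Θ))) (x y : Fin d → ℕ) :
    restrict hΘ φ (gen (cocycle (corner Θ)) x * star (gen (cocycle (corner Θ)) y))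
      = φ (gen (cocycle Θ) (inr x) * star (gen (cocycle Θ) (inr y))) := by
  rw [restrict_apply, blockMap_mul, blockMap_star, blockMap_gen, blockMap_gen]

lemma restrict_mem_plusTraces {φ : WeakDual ℂ (toeplitz (cocycle Θ))}
    (hφ : φ ∈ states (toeplitz (cocycle Θ))) (ht : IsTracial φ) :
    restrict hΘ φ ∈ plusTraces Θ := by
  refine ⟨⟨?_, fun a => ?_⟩, fun a b => ?_, fun x y h => ?_⟩
  · rw [restrict_apply, blockMap_one, hφ.1]
  · rw [restrict_apply, blockMap_mul, blockMap_star]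
    exact hφ.2 _
  · rw [restrict_apply, restrict_apply, blockMap_mul, blockMap_mul, ht]
  · rw [restrict_gen_mul_star, tracial_apply_eq_zero hΘ hφ ht h]

lemma restrict_eq_of_gen {φ : WeakDual ℂ (toeplitz (cocycle Θ))}
    {τ : WeakDual ℂ (toeplitz (cocycle (corner Θ)))}
    (h : ∀ x y : Fin d → ℕ, φ (gen (cocycle Θ) (inr x) * star (gen (cocycle Θ) (inr y)))
        = τ (gen (cocycle (corner Θ)) x * star (gen (cocycle (corner Θ)) y))) :
    restrict hΘ φ = τ := by
  have hd := dense_span_gen_mul_star (corner_transpose hΘ)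
  have h1 : WeakDual.toStrongDual (restrict hΘ φ) = WeakDual.toStrongDual τ := by
    refine ContinuousLinearMap.ext_on hd ?_
    rintro _ ⟨⟨x, y⟩, rfl⟩
    exact (restrict_gen_mul_star hΘ φ x y).trans (h x y)
  exact h1

/-- A functional with the product formula is determined by its restriction. -/
lemma eq_of_restrict_eq {φ ψ : WeakDual ℂ (toeplitz (cocycle Θ))}
    (hφ : ∀ (p q : Fin k → ℕ) (x y : Fin d → ℕ), φ (blockProd Θ p q x y) = if p = q then
      φ (gen (cocycle Θ) (inr x) * star (gen (cocycle Θ) (inr y))) else 0)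
    (hψ : ∀ (p q : Fin k → ℕ) (x y : Fin d → ℕ), ψ (blockProd Θ p q x y) = if p = q then
      ψ (gen (cocycle Θ) (inr x) * star (gen (cocycle Θ) (inr y))) else 0)
    (h : restrict hΘ φ = restrict hΘ ψ) : φ = ψ := by
  have hd := dense_span_blockProd hΘ
  have h1 : WeakDual.toStrongDual φ = WeakDual.toStrongDual ψ := by
    refine ContinuousLinearMap.ext_on hd ?_
    rintro _ ⟨p, q, x, y, rfl⟩
    change φ _ = ψ _
    rw [hφ, hψ, ← restrict_gen_mul_star hΘ, ← restrict_gen_mul_star hΘ, h]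
  exact h1

/-- The Gibbs states at β = 1/(n+1) have a limit by compactness, and the limit restricts to τ
because each of them does. -/
lemma exists_isKMSZeroPlus {r : Fin (k + d) → ℝ}
    (hr_pos : ∀ i : Fin k, 0 < r (Fin.castAdd d i))
    (hr_zero : ∀ j : Fin d, r (Fin.natAdd k j) = 0)
    {τ : WeakDual ℂ (toeplitz (cocycle (corner Θ)))} (hτ : τ ∈ plusTraces Θ) :
    ∃ φ, IsKMSZeroPlus (dynamics (cocycle Θ) r) φ ∧ restrict hΘ φ = τ := by
  have hβ : ∀ n : ℕ, 0 < 1 / ((n : ℝ) + 1) := fun n => Nat.one_div_pos_of_nat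
  choose ψ hψ hψa using fun n : ℕ => exists_isKMS hΘ hr_pos hr_zero (hβ n) hτ
  have hc := isCompact_of_isClosed_subset_states
    (isClosed_states (A := toeplitz (cocycle Θ))) subset_rfl
  -- A free ultrafilter replaces a subsequence: no metrisability is needed, and freeness ensures β →
  -- 0⁺.
  obtain ⟨φ, -, hφ⟩ := hc.ultrafilter_le_nhds ((hyperfilter ℕ).map ψ)
    (le_principal_iff.2 (Filter.mem_map.2 (Filter.univ_mem' fun n => (hψ n).1)))
  have hlim : Tendsto ψ (hyperfilter ℕ : Filter ℕ) (𝓝 φ) := hφ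
  refine ⟨φ, ⟨ℕ, hyperfilter ℕ, fun n => 1 / ((n : ℝ) + 1), ψ, inferInstance, ?_, hψ, hlim⟩,
    restrict_eq_of_gen hΘ fun x y => ?_⟩
  · refine (tendsto_nhdsWithin_iff.2
      ⟨tendsto_one_div_add_atTop_nhds_zero_nat, Eventually.of_forall hβ⟩).mono_left ?_
    rw [← Nat.cofinite_eq_atTop]
    exact hyperfilter_le_cofinite
  · refine tendsto_nhds_unique (tendsto_apply hlim _) ?_
    simp only [hψa]
    exact tendsto_const_nhds

/-- The characterisation of the `KMS_{0⁺}` states. -/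
lemma isKMSZeroPlus_iff {r : Fin (k + d) → ℝ}
    (hr_pos : ∀ i : Fin k, 0 < r (Fin.castAdd d i))
    (hr_zero : ∀ j : Fin d, r (Fin.natAdd k j) = 0) {φ : WeakDual ℂ (toeplitz (cocycle Θ))} :
    IsKMSZeroPlus (dynamics (cocycle Θ) r) φ ↔ φ ∈ states (toeplitz (cocycle Θ)) ∧ IsTracial φ ∧
      ∀ (p q : Fin k → ℕ) (x y : Fin d → ℕ), φ (blockProd Θ p q x y) = if p = q then
        φ (gen (cocycle Θ) (inr x) * star (gen (cocycle Θ) (inr y))) else 0 := by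
  refine ⟨fun h => ⟨h.mem_states, h.tracial, h.apply_blockProd hΘ hr_pos⟩, ?_⟩
  rintro ⟨hs, ht, hf⟩
  -- Some KMS_{0⁺} state has the same restriction as φ, and the product formula identifies the two.
  obtain ⟨ψ, hψ, hr⟩ := exists_isKMSZeroPlus hΘ hr_pos hr_zero (restrict_mem_plusTraces hΘ hs ht)
  rwa [eq_of_restrict_eq hΘ hf (hψ.apply_blockProd hΘ hr_pos) hr.symm]

end Traces

/-! ### Convexity, compactness and the homeomorphism -/

section Homeomorphism

variable {A : Type*} [NormedRing A] [NormedAlgebra ℂ A]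

lemma convex_isTracial : Convex ℝ {φ : WeakDual ℂ A | IsTracial φ} := by
  intro φ hφ ψ hψ s t _ _ _ a b
  change s • φ _ + t • ψ _ = s • φ _ + t • ψ _
  rw [hφ a b, hψ a b]

lemma convex_setOf_apply_eq (a b : A) : Convex ℝ {φ : WeakDual ℂ A | φ a = φ b} := by
  intro φ hφ ψ hψ s t _ _ _
  rw [Set.mem_ofPred_eq] at hφ hψ
  change s • φ _ + t • ψ _ = s • φ _ + t • ψ _
  rw [hφ, hψ]

variable {k d : ℕ} {Θ : Matrix (Fin (k + d)) (Fin (k + d)) ℝ} (hΘ : Θ.transpose = -Θ)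

lemma convex_plusTraces : Convex ℝ (plusTraces Θ) := by
  -- Vanishing is written as equality with τ(0), to fit `convex_setOf_apply_eq`.
  have h : plusTraces Θ = states (toeplitz (cocycle (corner Θ))) ∩
      ({τ | IsTracial τ} ∩ ⋂ x : Fin d → ℕ, ⋂ y : Fin d → ℕ, ⋂ _ : ¬ IsIntegralDiff Θ x y,
        {τ | τ (gen (cocycle (corner Θ)) x * star (gen (cocycle (corner Θ)) y)) = τ 0}) := by
    ext τ
    simp only [plusTraces, Set.mem_inter_iff, Set.mem_iInter, Set.mem_ofPred_eq, map_zero]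
  rw [h]
  exact convex_states.inter (convex_isTracial.inter (convex_iInter fun x => convex_iInter fun y =>
    convex_iInter fun _ => convex_setOf_apply_eq _ _))

include hΘ

variable {r : Fin (k + d) → ℝ} (hr_pos : ∀ i : Fin k, 0 < r (Fin.castAdd d i))
    (hr_zero : ∀ j : Fin d, r (Fin.natAdd k j) = 0)
include hr_pos hr_zero

/-- In this form every condition is convex and weak* closed, so convexity and compactness can be
read off. -/
lemma kmsZeroPlusStates_eq : kmsZeroPlusStates (dynamics (cocycle Θ) r) =
    states (toeplitz (cocycle Θ)) ∩ ({φ | IsTracial φ} ∩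
      ⋂ p : Fin k → ℕ, ⋂ q : Fin k → ℕ, ⋂ x : Fin d → ℕ, ⋂ y : Fin d → ℕ,
        {φ : WeakDual ℂ (toeplitz (cocycle Θ)) | φ (blockProd Θ p q x y) = φ (if p = q then
          gen (cocycle Θ) (inr x) * star (gen (cocycle Θ) (inr y)) else 0)}) := by
  ext φ
  refine (isKMSZeroPlus_iff hΘ hr_pos hr_zero).trans ?_
  simp only [Set.mem_inter_iff, Set.mem_iInter, Set.mem_ofPred_eq]
  refine and_congr_right fun _ => and_congr_right fun _ => ?_
  refine forall_congr' fun p => forall_congr' fun q => forall_congr' fun x => forall_congr' fun y =>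
    ?_
  split_ifs <;> simp

lemma convex_kmsZeroPlusStates : Convex ℝ (kmsZeroPlusStates (dynamics (cocycle Θ) r)) := by
  rw [kmsZeroPlusStates_eq hΘ hr_pos hr_zero]
  exact convex_states.inter (convex_isTracial.inter (convex_iInter fun p => convex_iInter fun q =>
    convex_iInter fun x => convex_iInter fun y => convex_setOf_apply_eq _ _))

lemma isCompact_kmsZeroPlusStates : IsCompact (kmsZeroPlusStates (dynamics (cocycle Θ) r)) := by
  refine isCompact_of_isClosed_subset_states ?_ fun φ h => IsKMSZeroPlus.mem_states h
  rw [kmsZeroPlusStates_eq hΘ hr_pos hr_zero]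
  exact isClosed_states.inter (isClosed_tracial.inter (isClosed_iInter fun p =>
    isClosed_iInter fun q => isClosed_iInter fun x => isClosed_iInter fun y =>
    isClosed_eq (WeakDual.eval_continuous _) (WeakDual.eval_continuous _)))

/-- Injectivity is the product formula and surjectivity is the limit of Gibbs states; compactness of
the source makes the inverse continuous. -/
lemma exists_homeomorph : ∃ R : kmsZeroPlusStates (dynamics (cocycle Θ) r) ≃ₜ plusTraces Θ,
    ∀ φ, (R φ : WeakDual ℂ (toeplitz (cocycle (corner Θ)))) = restrict hΘ φ.1 := by
  set K := kmsZeroPlusStates (dynamics (cocycle Θ) r) with hK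
  have : CompactSpace K :=
    isCompact_iff_compactSpace.1 (isCompact_kmsZeroPlusStates hΘ hr_pos hr_zero)
  let f : K → plusTraces Θ := fun φ =>
    ⟨restrict hΘ φ.1, restrict_mem_plusTraces hΘ φ.2.mem_states φ.2.tracial⟩
  have hf : Function.Bijective f := by
    refine ⟨fun φ ψ h => Subtype.ext ?_, fun τ => ?_⟩
    · exact eq_of_restrict_eq hΘ (φ.2.apply_blockProd hΘ hr_pos) (ψ.2.apply_blockProd hΘ hr_pos)
        (congrArg Subtype.val h)
    · obtain ⟨φ, hφ, h⟩ := exists_isKMSZeroPlus hΘ hr_pos hr_zero τ.2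
      exact ⟨⟨φ, hφ⟩, Subtype.ext h⟩
  have hc : Continuous f := by
    refine Continuous.subtype_mk (WeakDual.continuous_of_continuous_eval fun a => ?_) _
    exact (WeakDual.eval_continuous (blockMap hΘ a)).comp continuous_subtype_val
  have hc' : Continuous (Equiv.ofBijective f hf) := hc
  exact ⟨hc'.homeoOfEquivCompactToT2, fun φ => rfl⟩

end Homeomorphism

/-! ### Restriction as precomposition with the canonical isomorphism -/

section Affine

variable {k d : ℕ} {Θ : Matrix (Fin (k + d)) (Fin (k + d)) ℝ} (hΘ : Θ.transpose = -Θ)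

lemma restrict_apply_eq {S : Set (WeakDual ℂ (toeplitz (cocycle Θ)))}
    {T : Set (WeakDual ℂ (toeplitz (cocycle (corner Θ))))} {R : S ≃ₜ T}
    (hR : ∀ φ, (R φ : WeakDual ℂ (toeplitz (cocycle (corner Θ)))) = restrict hΘ φ.1)
    (φ : S) (a : toeplitz (cocycle (corner Θ))) :
    (R φ : WeakDual ℂ (toeplitz (cocycle (corner Θ)))) a =
      (φ : WeakDual ℂ (toeplitz (cocycle Θ))) (blockEquiv hΘ a : toeplitz (cocycle Θ)) :=
  (DFunLike.congr_fun (hR φ) a).trans (restrict_apply hΘ φ.1 a)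

lemma restrict_affine {S : Set (WeakDual ℂ (toeplitz (cocycle Θ)))}
    {T : Set (WeakDual ℂ (toeplitz (cocycle (corner Θ))))} {R : S ≃ₜ T}
    (hR : ∀ φ, (R φ : WeakDual ℂ (toeplitz (cocycle (corner Θ)))) = restrict hΘ φ.1)
    (φ ψ χ : S) (s t : ℝ)
    (h : (χ : WeakDual ℂ (toeplitz (cocycle Θ))) = s • φ.1 + t • ψ.1) :
    (R χ : WeakDual ℂ (toeplitz (cocycle (corner Θ)))) = s • (R φ).1 + t • (R ψ).1 :=
  calc (R χ : WeakDual ℂ (toeplitz (cocycle (corner Θ)))) = restrict hΘ χ.1 := hR χ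
    _ = restrict hΘ (s • φ.1 + t • ψ.1) := congrArg _ h
    _ = s • restrict hΘ φ.1 + t • restrict hΘ ψ.1 := rfl
    _ = s • (R φ).1 + t • (R ψ).1 :=
      congrArg₂ (fun u v => s • u + t • v) (hR φ).symm (hR ψ).symm

end Affine

end ToeplitzTorus

end

/-! ### The main theorem -/

open ToeplitzTorus

set_option maxHeartbeats 800000 in
theorem mainTheorem10 (k d : ℕ) (Θ : Matrix (Fin (k + d)) (Fin (k + d)) ℝ)
    (hΘ : Θ.transpose = -Θ)
    (r : Fin (k + d) → ℝ)
    (hr_pos : ∀ i : Fin k, 0 < r (Fin.castAdd d i))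
    (hr_zero : ∀ j : Fin d, r (Fin.natAdd k j) = 0) :
    -- characterisation of the KMS at zero-plus states among all states
    (∀ φ ∈ states (toeplitz (cocycle Θ)),
      IsKMSZeroPlus (dynamics (cocycle Θ) r) φ ↔
        (IsTracial φ ∧
          ∀ (p q : Fin k → ℕ) (x y : Fin d → ℕ),
            φ (gen (cocycle Θ) (inl p) * gen (cocycle Θ) (inr x) *
                star (gen (cocycle Θ) (inr y)) * star (gen (cocycle Θ) (inl q))) =
              if p = q then φ (gen (cocycle Θ) (inr x) * star (gen (cocycle Θ) (inr y)))
              else 0)) ∧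
    -- the canonical identification, under which restriction is an affine weak* homeomorphism
    (∃ ι : toeplitz (cocycle (corner Θ)) ≃⋆ₐ[ℂ] fixedBlock Θ,
      (∀ x : Fin d → ℕ, ι (gen (cocycle (corner Θ)) x) = fixedGen Θ x) ∧
      Isometry ι ∧
      Convex ℝ (kmsZeroPlusStates (dynamics (cocycle Θ) r)) ∧
      Convex ℝ (plusTraces Θ) ∧
      ∃ R : kmsZeroPlusStates (dynamics (cocycle Θ) r) ≃ₜ plusTraces Θ,
        (∀ (φ : kmsZeroPlusStates (dynamics (cocycle Θ) r))
            (a : toeplitz (cocycle (corner Θ))),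
          (R φ : WeakDual ℂ (toeplitz (cocycle (corner Θ)))) a =
            (φ : WeakDual ℂ (toeplitz (cocycle Θ))) (ι a : toeplitz (cocycle Θ))) ∧
        (∀ (φ ψ χ : kmsZeroPlusStates (dynamics (cocycle Θ) r)) (s t : ℝ),
          0 ≤ s → 0 ≤ t → s + t = 1 →
          (χ : WeakDual ℂ (toeplitz (cocycle Θ))) = s • φ.1 + t • ψ.1 →
          (R χ : WeakDual ℂ (toeplitz (cocycle (corner Θ)))) = s • (R φ).1 + t • (R ψ).1)) := by
  refine And.intro ?_ (Exists.intro (blockEquiv hΘ) ?_)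
  · intro φ hφ
    have h := isKMSZeroPlus_iff hΘ hr_pos hr_zero (φ := φ)
    constructor
    · intro hk
      exact (h.1 hk).2
    · intro hk
      exact h.2 ⟨hφ, hk⟩
  refine And.intro (blockEquiv_gen hΘ) ?_
  refine And.intro (blockEquiv_isometry hΘ) ?_
  refine And.intro (convex_kmsZeroPlusStates hΘ hr_pos hr_zero) ?_
  refine And.intro convex_plusTraces ?_
  exact (exists_homeomorph hΘ hr_pos hr_zero).imp fun _ hR =>
    ⟨restrict_apply_eq hΘ hR, fun φ ψ χ s t _ _ _ => restrict_affine hΘ hR φ ψ χ s t⟩
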